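/- **Lemma.** Propositional formulae are built from propositions $x_0,x_1,\dots$ and Boolean connectives, where a connective of arity $n\ge 0$ is identified with its Boolean function $\{0,1\}^n\to\{0,1\}$. For a set $B$ of Boolean functions, $\mathcal L(B)$ denotes the set of formulae using connectives from $B$ only, and $[B]$ the smallest clone containing $B$ (the smallest set of Boolean functions that contains all projections and $B$ and is closed under composition). Let - $\mathsf E$ be the set of Boolean functions that are constant or a conjunction of some of their arguments, - $\mathsf V$ the set of those that are constant or a disjunction of some of their arguments, - $\mathsf L$ the set of affine functions $c\oplus\bigoplus_{i\in I}x_i$ with $c\in\{0,1\}$ and $I$ a subset of the arguments. Let $\Sigma$ be a finite alphabet, let $\Pi\subseteq\Sigma^\star\times\mathcal L$, where $\mathcal L$ is the set of all formulae, and put $\Pi(B)=\Pi\cap(\Sigma^\star\times\mathcal L(B))$. Let $B$ be a finite set of Boolean functions, and suppose that $\Pi(B)$ is invariant under the substitution of equivalent formulae, i.e. $(x,\varphi)\in\Pi\iff(x,\psi)\in\Pi$ for all $x\in\Sigma^\star$, $\varphi\in\mathcal L(B)$ and all formulae $\psi$ equivalent to $\varphi$. Then for every finite set $B'$ of Boolean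 functions with $B\subseteq[B']$: 1. If $[B]\subseteq\mathsf E$ or $[B]\subseteq\mathsf V$, then $\Pi(B)\le_{\mathrm{AC}^0}\Pi(B')$. 2. If $[B]\subseteq\mathsf L$, then $\Pi(B)\le_{\mathrm{AC}^0[2]}\Pi(B')$. Here $\Pi(B)\le_{\mathcal C}\Pi(B')$ means that there is a $\mathcal C$-computable map that sends every encoding of an instance $(x,\varphi)\in\Sigma^\star\times\mathcal L(B)$ to an encoding of an instance $(x',\varphi')\in\Sigma^\star\times\mathcal L(B')$ with $(x,\varphi)\in\Pi(B)\iff(x',\varphi')\in\Pi(B')$. The class $\mathrm{AC}^0$ is that of DLOGTIME-uniform circuit families of constant depth and polynomial size with unbounded fan-in (circuits described by first-order formulae with built-in order, addition, multiplication and binary digits), and $\mathrm{AC}^0[2]$ allows parity gates in addition. An instance $(x,\varphi)$ is encoded by Boolean tables over a universe $\{0,\dots,n-1\}$, $n\ge 2$ (with padding allowed), listing: the letters of $x$; for every node of the formula tree of $\varphi$ its connective, or the binary digits of the index of its proposition; which node is the $i$-th argument of which node; and which node lies in the subformula rooted at which node. -/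

import Mathlib

namespace PostLattice

/-! ### Boolean functions and clones -/

/-- A Boolean function (equivalently, a Boolean connective) together with its arity. Arity `0`,
i.e. the constants as nullary connectives, is allowed. -/
abbrev BoolFn : Type := Σ n : ℕ, ((Fin n → Bool) → Bool)

/-- A clone contains all projections and is closed under composition. -/
structure IsClone (C : Set BoolFn) : Prop where
  proj : ∀ (n : ℕ) (i : Fin n), (⟨n, fun a => a i⟩ : BoolFn) ∈ C
  comp : ∀ (m n : ℕ) (f : (Fin m → Bool) → Bool) (g : Fin m → (Fin n → Bool) → Bool),
    (⟨m, f⟩ : BoolFn) ∈ C → (∀ i, (⟨n, g i⟩ : BoolFn) ∈ C) →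
    (⟨n, fun a => f (fun i => g i a)⟩ : BoolFn) ∈ C

/-- `[B]`, the smallest clone containing `B`. -/
def clone (B : Set BoolFn) : Set BoolFn := {f | ∀ C, IsClone C → B ⊆ C → f ∈ C}

/-- `E`: the functions that are constant or a conjunction of some of their arguments. -/
def cloneE : Set BoolFn :=
  {f | (∃ c : Bool, ∀ a, f.2 a = c) ∨
    ∃ I : Finset (Fin f.1), ∀ a, f.2 a = true ↔ ∀ i ∈ I, a i = true}

/-- `V`: the functions that are constant or a disjunction of some of their arguments. -/
def cloneV : Set BoolFn :=
  {f | (∃ c : Bool, ∀ a, f.2 a = c) ∨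
    ∃ I : Finset (Fin f.1), ∀ a, f.2 a = true ↔ ∃ i ∈ I, a i = true}

/-- `L`: the affine functions `c ⊕ ⨁_{i ∈ I} x_i`. -/
def cloneL : Set BoolFn :=
  {f | ∃ (c : Bool) (I : Finset (Fin f.1)), ∀ a,
    f.2 a = xor c (decide (Odd (I.filter (fun i => a i = true)).card))}

/-! ### Propositional formulae -/

/-- Propositional formulae over the propositions `x_0, x_1, …` and arbitrary connectives. -/
inductive Fml : Type
  | var (k : ℕ) : Fml
  | app (c : BoolFn) (args : Fin c.1 → Fml) : Fml

/-- The truth value of a formula under an assignment. -/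
def Fml.eval (σ : ℕ → Bool) : Fml → Bool
  | .var k => σ k
  | .app c args => c.2 (fun i => (args i).eval σ)

/-- Logical equivalence. -/
def Fml.Equiv (φ ψ : Fml) : Prop := ∀ σ, φ.eval σ = ψ.eval σ

/-- `φ` is a `B`-formula: it uses connectives from `B` only. -/
def Fml.IsOver (B : Set BoolFn) : Fml → Prop
  | .var _ => True
  | .app c args => c ∈ B ∧ ∀ i, (args i).IsOver B

/-- The subformula of `φ` at an address; an address lists the argument numbers on the way down
from the root, and `none` means that it leads out of the formula. -/
def Fml.subAt : Fml → List ℕ → Option Fml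
  | φ, [] => some φ
  | .var _, _ :: _ => none
  | .app c args, i :: p => if h : i < c.1 then (args ⟨i, h⟩).subAt p else none

/-- A decision problem over formulae: a set of pairs (word over `S`, formula). -/
abbrev FmlProblem (S : Type) : Type := Set (List S × Fml)

/-- `Π(B)`, the restriction of `Π` to `B`-formulae. -/
def FmlProblem.restrict {S : Type} (P : FmlProblem S) (B : Set BoolFn) : FmlProblem S :=
  {z | z ∈ P ∧ z.2.IsOver B}

/-- `Π(B)` is invariant under the substitution of equivalent formulae: replacing a `B`-formula
in an instance by any equivalent formula does not change membership in `Π`. -/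
def FmlProblem.Invariant {S : Type} (P : FmlProblem S) (B : Set BoolFn) : Prop :=
  ∀ (x : List S) (φ ψ : Fml), φ.IsOver B → φ.Equiv ψ → ((x, φ) ∈ P ↔ (x, ψ) ∈ P)

/-! ### Constant-depth circuits -/

/-- Circuits with unbounded fan-in over input bits indexed by `I`. They are written as trees;
for constant depth and polynomial size this is no restriction. -/
inductive Circuit (I : Type) : Type
  | const (b : Bool) : Circuit I
  | input (i : I) : Circuit I
  | not (C : Circuit I) : Circuit I
  | and (m : ℕ) (C : Fin m → Circuit I) : Circuit I
  | or (m : ℕ) (C : Fin m → Circuit I) : Circuit I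
  | xor (m : ℕ) (C : Fin m → Circuit I) : Circuit I

namespace Circuit

variable {I : Type}

/-- The output bit of a circuit; a `xor` gate is a MOD-2 gate of unbounded fan-in. -/
def eval (w : I → Bool) : Circuit I → Bool
  | const b => b
  | input i => w i
  | not C => !(C.eval w)
  | and _ C => decide (∀ i, (C i).eval w = true)
  | or _ C => decide (∃ i, (C i).eval w = true)
  | xor _ C => decide (Odd (Finset.univ.filter (fun i => (C i).eval w = true)).card)

/-- The depth of a circuit. -/
def depth : Circuit I → ℕ
  | const _ => 0
  | input _ => 0
  | not C => C.depth + 1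
  | and _ C => (Finset.univ.sup fun i => (C i).depth) + 1
  | or _ C => (Finset.univ.sup fun i => (C i).depth) + 1
  | xor _ C => (Finset.univ.sup fun i => (C i).depth) + 1

/-- The number of gates of a circuit. -/
def size : Circuit I → ℕ
  | const _ => 1
  | input _ => 1
  | not C => C.size + 1
  | and _ C => (∑ i, (C i).size) + 1
  | or _ C => (∑ i, (C i).size) + 1
  | xor _ C => (∑ i, (C i).size) + 1

/-- The circuit has no MOD-2 gate. -/
def XorFree : Circuit I → Prop
  | const _ => True
  | input _ => True
  | not C => C.XorFree
  | and _ C => ∀ i, (C i).XorFree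
  | or _ C => ∀ i, (C i).XorFree
  | xor _ _ => False

end Circuit

/-- A relational vocabulary. -/
structure Vocabulary where
  Rel : Type
  arity : Rel → ℕ

/-- The entries of a table of size `n`: a relation symbol with a tuple over `{0, …, n-1}`. -/
abbrev Vocabulary.Entry (V : Vocabulary) (n : ℕ) : Type := Σ r : V.Rel, (Fin (V.arity r) → Fin n)

/-- A table of size `n`: one bit for every entry, that is, a family of relations on
`{0, …, n-1}`. For a finite vocabulary these are polynomially many bits. -/
abbrev Table (V : Vocabulary) (n : ℕ) : Type := V.Entry n → Bool

/-- A uniform description of a family of circuits, with indices named by `α`: for every `n` and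
every choice of the indices in `{0, …, n-1}` it unfolds to a circuit on tables of size `n`. -/
inductive Desc (V : Vocabulary) : Type → Type 1
  | lt {α : Type} (x y : α) : Desc V α
  | eq {α : Type} (x y : α) : Desc V α
  | add {α : Type} (x y z : α) : Desc V α
  | mul {α : Type} (x y z : α) : Desc V α
  | bit {α : Type} (x y : α) : Desc V α
  | input {α : Type} (r : V.Rel) (x : Fin (V.arity r) → α) : Desc V α
  | not {α : Type} (D : Desc V α) : Desc V α
  | and {α : Type} (D E : Desc V α) : Desc V α
  | or {α : Type} (D E : Desc V α) : Desc V α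
  | bigAnd {α : Type} (D : Desc V (Option α)) : Desc V α
  | bigOr {α : Type} (D : Desc V (Option α)) : Desc V α
  | bigXor {α : Type} (D : Desc V (Option α)) : Desc V α

namespace Desc

variable {V : Vocabulary}

/-- The circuit for tables of size `n` described by `D`. The arithmetical conditions on indices
(order, equality, sum, product, binary digits) do not depend on the table: they are hard-wired
constants of the circuit. `bigAnd`, `bigOr`, `bigXor` yield gates of fan-in `n`, one wire for
each value of the new index `none`. A description is a first-order formula with built-in
arithmetic (and parity quantifiers), so the circuit families obtained are the
DLOGTIME-uniform families for `AC⁰` (and `AC⁰[2]`). -/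
def circuit (n : ℕ) : {α : Type} → Desc V α → (α → Fin n) → Circuit (V.Entry n)
  | _, lt x y, e => .const (decide (e x < e y))
  | _, eq x y, e => .const (decide (e x = e y))
  | _, add x y z, e => .const (decide ((e x : ℕ) + (e y : ℕ) = (e z : ℕ)))
  | _, mul x y z, e => .const (decide ((e x : ℕ) * (e y : ℕ) = (e z : ℕ)))
  | _, bit x y, e => .const ((e x : ℕ).testBit (e y : ℕ))
  | _, input r x, e => .input ⟨r, fun i => e (x i)⟩
  | _, not D, e => .not (D.circuit n e)
  | _, and D E, e => .and 2 ![D.circuit n e, E.circuit n e]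
  | _, or D E, e => .or 2 ![D.circuit n e, E.circuit n e]
  | _, bigAnd D, e => .and n fun v => D.circuit n fun o => o.elim v e
  | _, bigOr D, e => .or n fun v => D.circuit n fun o => o.elim v e
  | _, bigXor D, e => .xor n fun v => D.circuit n fun o => o.elim v e

/-- The description does not use MOD-2 gates. -/
def XorFree : {α : Type} → Desc V α → Prop
  | _, lt _ _ => True
  | _, eq _ _ => True
  | _, add _ _ _ => True
  | _, mul _ _ _ => True
  | _, bit _ _ => True
  | _, input _ _ => True
  | _, not D => D.XorFree
  | _, and D E => D.XorFree ∧ E.XorFree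
  | _, or D E => D.XorFree ∧ E.XorFree
  | _, bigAnd D => D.XorFree
  | _, bigOr D => D.XorFree
  | _, bigXor _ => False

/-- The described circuits have constant depth. -/
theorem depth_bounded {α : Type} (D : Desc V α) :
    ∃ d : ℕ, ∀ n e, (D.circuit n e).depth ≤ d := by
  induction D with
  | not D ih =>
    obtain ⟨d, hd⟩ := ih
    exact ⟨d + 1, fun n e => by simpa [circuit, Circuit.depth] using hd n e⟩
  | and D E ih₁ ih₂ =>
    obtain ⟨d, hd⟩ := ih₁
    obtain ⟨d', hd'⟩ := ih₂
    refine ⟨max d d' + 1, fun n e => ?_⟩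
    simp only [circuit, Circuit.depth, add_le_add_iff_right, Finset.sup_le_iff]
    intro i _
    fin_cases i
    · exact le_max_of_le_left (hd n e)
    · exact le_max_of_le_right (hd' n e)
  | or D E ih₁ ih₂ =>
    obtain ⟨d, hd⟩ := ih₁
    obtain ⟨d', hd'⟩ := ih₂
    refine ⟨max d d' + 1, fun n e => ?_⟩
    simp only [circuit, Circuit.depth, add_le_add_iff_right, Finset.sup_le_iff]
    intro i _
    fin_cases i
    · exact le_max_of_le_left (hd n e)
    · exact le_max_of_le_right (hd' n e)
  | bigAnd D ih =>
    obtain ⟨d, hd⟩ := ih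
    exact ⟨d + 1, fun n e => by
      simpa [circuit, Circuit.depth] using fun v => hd n _⟩
  | bigOr D ih =>
    obtain ⟨d, hd⟩ := ih
    exact ⟨d + 1, fun n e => by
      simpa [circuit, Circuit.depth] using fun v => hd n _⟩
  | bigXor D ih =>
    obtain ⟨d, hd⟩ := ih
    exact ⟨d + 1, fun n e => by
      simpa [circuit, Circuit.depth] using fun v => hd n _⟩
  | _ => exact ⟨0, fun n e => by simp [circuit, Circuit.depth]⟩

/-- The described circuits have polynomial size. -/
theorem size_bounded {α : Type} (D : Desc V α) :
    ∃ p : Polynomial ℕ, ∀ n e, (D.circuit n e).size ≤ p.eval n := by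
  have big : ∀ (n : ℕ) (q : ℕ) (f : Fin n → ℕ), (∀ v, f v ≤ q) → ∑ v, f v ≤ n * q := by
    intro n q f h
    simpa using Finset.sum_le_card_nsmul Finset.univ f q (fun v _ => h v)
  induction D with
  | not D ih =>
    obtain ⟨p, hp⟩ := ih
    exact ⟨p + 1, fun n e => by simpa [circuit, Circuit.size] using hp n e⟩
  | and D E ih₁ ih₂ =>
    obtain ⟨p, hp⟩ := ih₁
    obtain ⟨q, hq⟩ := ih₂
    refine ⟨p + q + 1, fun n e => ?_⟩
    simpa [circuit, Circuit.size] using add_le_add (hp n e) (hq n e)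
  | or D E ih₁ ih₂ =>
    obtain ⟨p, hp⟩ := ih₁
    obtain ⟨q, hq⟩ := ih₂
    refine ⟨p + q + 1, fun n e => ?_⟩
    simpa [circuit, Circuit.size] using add_le_add (hp n e) (hq n e)
  | bigAnd D ih =>
    obtain ⟨p, hp⟩ := ih
    refine ⟨Polynomial.X * p + 1, fun n e => ?_⟩
    simpa [circuit, Circuit.size] using big n _ _ (fun v => hp n _)
  | bigOr D ih =>
    obtain ⟨p, hp⟩ := ih
    refine ⟨Polynomial.X * p + 1, fun n e => ?_⟩
    simpa [circuit, Circuit.size] using big n _ _ (fun v => hp n _)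
  | bigXor D ih =>
    obtain ⟨p, hp⟩ := ih
    refine ⟨Polynomial.X * p + 1, fun n e => ?_⟩
    simpa [circuit, Circuit.size] using big n _ _ (fun v => hp n _)
  | _ => exact ⟨1, fun n e => by simp [circuit, Circuit.size]⟩

/-- A description without MOD-2 gates unfolds to circuits without MOD-2 gates. -/
theorem xorFree_circuit {α : Type} (D : Desc V α) (hD : D.XorFree) (n : ℕ) (e : α → Fin n) :
    (D.circuit n e).XorFree := by
  induction D with
  | not D ih => exact ih hD e
  | and D E ih₁ ih₂ =>
    intro i
    fin_cases i
    · exact ih₁ hD.1 e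
    · exact ih₂ hD.2 e
  | or D E ih₁ ih₂ =>
    intro i
    fin_cases i
    · exact ih₁ hD.1 e
    · exact ih₂ hD.2 e
  | bigAnd D ih => exact fun v => ih hD _
  | bigOr D ih => exact fun v => ih hD _
  | bigXor D ih => exact hD.elim
  | _ => trivial

end Desc

/-- A uniform constant-depth circuit family with many output bits. It maps tables of size `n` to
tables of size `n ^ k`; every output bit has its own circuit, described uniformly in terms of the
output entry, whose arguments are written with `k` digits in base `n`. -/
structure CircuitMap (V W : Vocabulary) where
  k : ℕ
  desc : ∀ r : W.Rel, Desc V (Fin (W.arity r) × Fin k)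

/-- The output table of a circuit family on an input table. -/
def CircuitMap.run {V W : Vocabulary} (F : CircuitMap V W) {n : ℕ} (T : Table V n) :
    Table W (n ^ F.k) :=
  fun z => ((F.desc z.1).circuit n
    (fun ij => finFunctionFinEquiv.symm (z.2 ij.1) ij.2)).eval T

/-- The family uses no MOD-2 gates. -/
def CircuitMap.XorFree {V W : Vocabulary} (F : CircuitMap V W) : Prop :=
  ∀ r, (F.desc r).XorFree

/-! ### Instances as tables -/

/-- The relations of an instance (word `x` over `S`, `B`-formula `φ`):
`letter a i`: the `i`-th letter of `x` is `a`;
`conn c u`: the node `u` of `φ` carries the connective `c`;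
`prop u`: the node `u` is an occurrence of a proposition;
`name u j`: moreover, the `j`-th binary digit of the number of this proposition is `1`;
`arg c i u v`: the node `u` carries `c`, and its `i`-th argument is the node `v`;
`below u v`: the node `v` belongs to the subformula with root `u`. -/
inductive InstRel (S : Type) (B : Finset BoolFn) : Type
  | letter (a : S) : InstRel S B
  | conn (c : B) : InstRel S B
  | prop : InstRel S B
  | name : InstRel S B
  | arg (c : B) (i : Fin c.1.1) : InstRel S B
  | below : InstRel S B

/-- The vocabulary of instances. -/
def instVoc (S : Type) (B : Finset BoolFn) : Vocabulary where
  Rel := InstRel S B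
  arity
    | .letter _ => 1
    | .conn _ => 1
    | .prop => 1
    | .name => 2
    | .arg _ _ => 2
    | .below => 2

/-- The relation `r`, of arity one, holds of `u` in the table. -/
def holds₁ {S : Type} {B : Finset BoolFn} {n : ℕ} (T : Table (instVoc S B) n)
    (r : InstRel S B) (u : Fin n) : Prop := T ⟨r, fun _ => u⟩ = true

/-- The relation `r`, of arity two, holds of `(u, v)` in the table. -/
def holds₂ {S : Type} {B : Finset BoolFn} {n : ℕ} (T : Table (instVoc S B) n)
    (r : InstRel S B) (u v : Fin n) : Prop :=
  T ⟨r, fun i => if (i : ℕ) = 0 then u else v⟩ = true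

/-- The table `T` encodes the instance `(x, φ)`, where `φ` is a `B`-formula: the occurrences of
subformulae (given by their addresses) are mapped injectively by `ν` to nodes, and the relations
are exactly the intended ones. Elements that are not nodes serve as padding. -/
def Encodes {S : Type} (B : Finset BoolFn) {n : ℕ} (T : Table (instVoc S B) n)
    (z : List S × Fml) : Prop :=
  2 ≤ n ∧ z.2.IsOver (B : Set BoolFn) ∧
  -- the word
  z.1.length ≤ n ∧ (∀ (a : S) (i : Fin n), holds₁ T (.letter a) i ↔ z.1[(i : ℕ)]? = some a) ∧
  -- the formula
  ∃ ν : List ℕ → Fin n,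
    (∀ p q, z.2.subAt p ≠ none → z.2.subAt q ≠ none → ν p = ν q → p = q) ∧
    (∀ p k, z.2.subAt p = some (.var k) → k < 2 ^ n) ∧
    (∀ (c : B) (u : Fin n), holds₁ T (.conn c) u ↔
      ∃ p args, z.2.subAt p = some (.app c.1 args) ∧ ν p = u) ∧
    (∀ u : Fin n, holds₁ T .prop u ↔ ∃ p k, z.2.subAt p = some (.var k) ∧ ν p = u) ∧
    (∀ u j : Fin n, holds₂ T .name u j ↔
      ∃ p k, z.2.subAt p = some (.var k) ∧ ν p = u ∧ k.testBit (j : ℕ) = true) ∧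
    (∀ (c : B) (i : Fin c.1.1) (u v : Fin n), holds₂ T (.arg c i) u v ↔
      ∃ p args, z.2.subAt p = some (.app c.1 args) ∧ ν p = u ∧ ν (p ++ [(i : ℕ)]) = v) ∧
    (∀ u v : Fin n, holds₂ T .below u v ↔
      ∃ p q, z.2.subAt p ≠ none ∧ z.2.subAt q ≠ none ∧ p <+: q ∧ ν p = u ∧ ν q = v)

/-! ### Every instance has an encoding, and encodings are unambiguous -/

theorem subAt_finite (φ : Fml) : {p | φ.subAt p ≠ none}.Finite := by
  induction φ with
  | var k =>
    refine (Set.finite_singleton []).subset ?_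
    intro p hp
    cases p with
    | nil => rfl
    | cons i p => simp [Fml.subAt] at hp
  | app c args ih =>
    refine ((Set.finite_singleton []).union
      (Set.finite_iUnion fun i : Fin c.1 => (ih i).image (List.cons (i : ℕ)))).subset ?_
    intro p hp
    cases p with
    | nil => left; rfl
    | cons i p =>
      right
      by_cases h : i < c.1
      · simp only [Set.mem_iUnion]
        exact ⟨⟨i, h⟩, p, by simpa [Fml.subAt, h] using hp, rfl⟩
      · simp [Fml.subAt, h] at hp

/-- Every pair of a word and a `B`-formula has an encoding. -/
theorem exists_encodes {S : Type} (B : Finset BoolFn) (x : List S) (φ : Fml)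
    (hφ : φ.IsOver (B : Set BoolFn)) :
    ∃ (n : ℕ) (T : Table (instVoc S B) n), Encodes B T (x, φ) := by
  classical
  have hfin := subAt_finite φ
  let A := hfin.toFinset
  let g : List ℕ → ℕ := fun p => match φ.subAt p with | some (.var k) => k | _ => 0
  let n := 2 + x.length + A.card + A.sup g
  have hn : A.card < n := by simp only [n]; omega
  let ν : List ℕ → Fin n := fun p =>
    if h : p ∈ A then (A.equivFin ⟨p, h⟩).castLE hn.le else ⟨0, by omega⟩
  let T : Table (instVoc S B) n := fun z => match z with
    | ⟨.letter a, t⟩ => decide (x[(t (0 : Fin 1) : ℕ)]? = some a)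
    | ⟨.conn c, t⟩ => decide (∃ p args, φ.subAt p = some (.app c.1 args) ∧ ν p = t (0 : Fin 1))
    | ⟨.prop, t⟩ => decide (∃ p k, φ.subAt p = some (.var k) ∧ ν p = t (0 : Fin 1))
    | ⟨.name, t⟩ => decide (∃ p k, φ.subAt p = some (.var k) ∧ ν p = t (0 : Fin 2) ∧ k.testBit (t (1 : Fin 2) : ℕ))
    | ⟨.arg c i, t⟩ => decide (∃ p args, φ.subAt p = some (.app c.1 args) ∧ ν p = t (0 : Fin 2) ∧
        ν (p ++ [(i : ℕ)]) = t (1 : Fin 2))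
    | ⟨.below, t⟩ => decide (∃ p q, φ.subAt p ≠ none ∧ φ.subAt q ≠ none ∧ p <+: q ∧ ν p = t (0 : Fin 2) ∧
        ν q = t (1 : Fin 2))
  refine ⟨n, T, by omega, hφ, by simp only [n]; omega, ?_, ν, ?_, ?_, ?_, ?_, ?_, ?_, ?_⟩
  · intro a i; exact decide_eq_true_iff
  · intro p q hp hq h
    have hp : p ∈ A := by simpa [A] using hp
    have hq : q ∈ A := by simpa [A] using hq
    simp only [ν, hp, hq, dif_pos] at h
    simpa using h
  · intro p k hk
    have hp : p ∈ A := by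
      simp only [A, Set.Finite.mem_toFinset, Set.mem_ofPred_eq]
      exact fun h => by simp_all
    have : g p ≤ A.sup g := Finset.le_sup hp
    have hg : g p = k := by
      have hk' : φ.subAt p = some (.var k) := hk
      simp only [g, hk']
    have : k ≤ n := by simp only [n]; omega
    exact lt_of_le_of_lt this Nat.lt_two_pow_self
  · intro c u; exact decide_eq_true_iff
  · intro u; exact decide_eq_true_iff
  · intro u j; exact decide_eq_true_iff
  · intro c i u v; exact decide_eq_true_iff
  · intro u v; exact decide_eq_true_iff

theorem subAt_append (φ : Fml) (p q : List ℕ) :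
    φ.subAt (p ++ q) = (φ.subAt p).bind (fun ψ => ψ.subAt q) := by
  induction p generalizing φ with
  | nil => cases φ <;> simp [Fml.subAt]
  | cons i p ih =>
    cases φ with
    | var k => simp [Fml.subAt]
    | app c args =>
      by_cases h : i < c.1
      · simp [Fml.subAt, h, ih]
      · simp [Fml.subAt, h]

theorem subAt_nil (φ : Fml) : φ.subAt [] = some φ := by cases φ <;> rfl

theorem isOver_subAt {B : Set BoolFn} {φ ψ : Fml} {p : List ℕ} (h : φ.IsOver B)
    (hp : φ.subAt p = some ψ) : ψ.IsOver B := by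
  induction p generalizing φ with
  | nil => rw [subAt_nil] at hp; cases hp; exact h
  | cons i p ih =>
    cases φ with
    | var k => simp [Fml.subAt] at hp
    | app c args =>
      by_cases h' : i < c.1
      · simp only [Fml.subAt, h', dif_pos] at hp
        exact ih (h.2 _) hp
      · simp [Fml.subAt, h'] at hp

/-- A table encodes at most one instance. -/
theorem encodes_unique {S : Type} (B : Finset BoolFn) {n : ℕ} (T : Table (instVoc S B) n)
    (z z' : List S × Fml) (h : Encodes B T z) (h' : Encodes B T z') : z = z' := by
  obtain ⟨x, φ⟩ := z
  obtain ⟨x', φ'⟩ := z'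
  obtain ⟨-, ho, hx, hl, ν, i1, i2, i3, i4, i5, i6, i7⟩ := h
  obtain ⟨-, ho', hx', hl', μ, j1, j2, j3, j4, j5, j6, j7⟩ := h'
  dsimp only at *
  have hxx : x = x' := by
    apply List.ext_getElem?
    intro i
    by_cases hi : i < n
    · apply Option.ext
      intro a
      exact (hl a ⟨i, hi⟩).symm.trans (hl' a ⟨i, hi⟩)
    · rw [List.getElem?_eq_none (by omega), List.getElem?_eq_none (by omega)]
  have key : ∀ (ψ : Fml) (p q : List ℕ) (ψ' : Fml), φ.subAt p = some ψ → φ'.subAt q = some ψ' →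
      ν p = μ q → ψ = ψ' := by
    intro ψ
    induction ψ with
    | var k =>
      intro p q ψ' hp hq e
      obtain ⟨q', k', hq', e'⟩ := (j4 (ν p)).1 ((i4 _).2 ⟨p, k, hp, rfl⟩)
      have : q' = q := j1 _ _ (by simp [hq']) (by simp [hq]) (e'.trans e)
      subst this
      rw [hq'] at hq
      cases hq
      congr 1
      apply Nat.eq_of_testBit_eq
      intro j
      by_cases hj : j < n
      · rw [Bool.eq_iff_iff]
        have := (i5 (ν p) ⟨j, hj⟩).symm.trans (j5 (ν p) ⟨j, hj⟩)
        constructor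
        · intro hb
          obtain ⟨r, l, hr, er, hb'⟩ := this.1 ⟨p, k, hp, rfl, hb⟩
          have : r = q' := j1 _ _ (by simp [hr]) (by simp [hq']) (er.trans e)
          subst this
          rw [hq'] at hr; cases hr; exact hb'
        · intro hb
          obtain ⟨r, l, hr, er, hb'⟩ := this.2 ⟨q', k', hq', e', hb⟩
          have : r = p := i1 _ _ (by simp [hr]) (by simp [hp]) er
          subst this
          rw [hp] at hr; cases hr; exact hb'
      · push Not at hj
        rw [Nat.testBit_lt_two_pow (lt_of_lt_of_le (i2 p k hp) (Nat.pow_le_pow_right (by simp) hj)),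
          Nat.testBit_lt_two_pow (lt_of_lt_of_le (j2 q' k' hq') (Nat.pow_le_pow_right (by simp) hj))]
    | app c args ih =>
      intro p q ψ' hp hq e
      have hc : c ∈ B := by simpa using (isOver_subAt ho hp).1
      obtain ⟨q', args', hq', e'⟩ := (j3 ⟨c, hc⟩ (ν p)).1 ((i3 ⟨c, hc⟩ _).2 ⟨p, args, hp, rfl⟩)
      have : q' = q := j1 _ _ (by simp [hq']) (by simp [hq]) (e'.trans e)
      subst this
      rw [hq'] at hq
      cases hq
      congr 1
      funext i
      have s1 : φ.subAt (p ++ [(i : ℕ)]) = some (args i) := by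
        rw [subAt_append, hp]; simp [Fml.subAt, subAt_nil]
      have s2 : φ'.subAt (q' ++ [(i : ℕ)]) = some (args' i) := by
        rw [subAt_append, hq']; simp [Fml.subAt, subAt_nil]
      obtain ⟨r, b, hr, er, er'⟩ := (j6 ⟨c, hc⟩ i (ν p) (ν (p ++ [(i : ℕ)]))).1
        ((i6 ⟨c, hc⟩ i _ _).2 ⟨p, args, hp, rfl, rfl⟩)
      have : r = q' := j1 _ _ (by simp [hr]) (by simp [hq']) (er.trans e)
      subst this
      exact ih i _ _ _ s1 s2 er'.symm
  have root : ν [] = μ [] := by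
    -- the root is the only node above all nodes
    have a1 : holds₂ T .below (μ []) (μ []) :=
      (j7 _ _).2 ⟨[], [], by simp [subAt_nil], by simp [subAt_nil], List.prefix_rfl, rfl, rfl⟩
    obtain ⟨p, q, hp, hq, -, e1, e2⟩ := (i7 _ _).1 a1
    have a2 : holds₂ T .below (ν []) (μ []) :=
      (i7 _ _).2 ⟨[], p, by simp [subAt_nil], hp, List.nil_prefix, rfl, e1⟩
    obtain ⟨r, s, hr, hs, hrs, e3, e4⟩ := (j7 _ _).1 a2
    have : s = [] := j1 _ _ hs (by simp [subAt_nil]) e4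
    subst this
    rw [List.prefix_nil] at hrs
    subst hrs
    exact e3.symm
  rw [hxx, key φ [] [] φ' (subAt_nil _) (subAt_nil _) root]

/-! ### Reductions -/

/-- `F` is a many-one reduction from `Π(B)` to `Π(B')`: it maps every encoding of an instance of
`Π(B)` to an encoding of an instance of `Π(B')` with the same answer. -/
def CircuitMap.Reduces {S : Type} {B B' : Finset BoolFn}
    (F : CircuitMap (instVoc S B) (instVoc S B')) (P : FmlProblem S) : Prop :=
  ∀ (n : ℕ) (T : Table (instVoc S B) n) (z : List S × Fml), Encodes B T z →
    ∃ z' : List S × Fml, Encodes B' (F.run T) z' ∧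
      (z ∈ P.restrict (B : Set BoolFn) ↔ z' ∈ P.restrict (B' : Set BoolFn))

/-- `Π(B) ≤ Π(B')` by many-one reductions computable in (uniform) `AC⁰`. -/
def ReducesAC0 {S : Type} (P : FmlProblem S) (B B' : Finset BoolFn) : Prop :=
  ∃ F : CircuitMap (instVoc S B) (instVoc S B'), F.XorFree ∧ F.Reduces P

/-- `Π(B) ≤ Π(B')` by many-one reductions computable in (uniform) `AC⁰[2]`. -/
def ReducesAC0Mod2 {S : Type} (P : FmlProblem S) (B B' : Finset BoolFn) : Prop :=
  ∃ F : CircuitMap (instVoc S B) (instVoc S B'), F.Reduces P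

end PostLattice

namespace PostLattice

/-! All three cases are one case. There is a bijection `ι` from `Bool` onto a two-element
commutative monoid in which every connective of `B` is a constant times the product of some of its
arguments: conjunction for `E`, conjunction after negating all values for `V`, addition modulo two
for `L`. The monoid is idempotent in the first two cases and a group of exponent two in the third
(`IsProductBase`).

Hence the value of a formula is a constant `C` times the product of the propositions at its relevant
nodes, those reached from the root through relevant arguments only (`IsNodeMap.eval_eq_prod`). The
given relation `below` makes reachability first-order. The constant is a product over all nodes:
deciding whether it is 1 takes a universal quantifier in the idempotent case and one parity in the
group case.

The output formula is a balanced product of about logarithmic depth. If some connective has two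
relevant arguments, nested copies of it express a constant-free product of five arguments, hence so
does a formula `A` over `B'`. If no connective does, at most one proposition is relevant and depth
zero suffices. Each relevant node owns one bottom position, addressed by its binary digits; the
other positions are padding.

Constants need not be expressible over `B'`, so `C` is brought in by the unary function `g` that
gives the value of the input when all propositions agree. It is induced by a `B`-formula, hence
expressible over `B'`. Applying `g` or the identity at relevant positions, and `g` or the identity
at padding positions, produces `C` exactly; in the group case this uses that the number of positions
is odd (`IsProductBase.prod_leafFunctions`, `equiv_nest`).

Logarithmic depth makes the construction local: a node is a word of template leaves plus a position
in a fixed block, the word is stored as bit sets in boundedly many elements, and all output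
relations become first-order in these codes (`outRel`, `isNodeMap_output`). Invariance of the
problem under equivalence then gives the reduction. -/

/-! ### Predicates described by uniform constant-depth circuits -/

/-- The predicate `P` on tables and indices is decided by a uniform family of constant-depth
circuits, which may use MOD-2 gates only if `par` holds. -/
def Definable (par : Prop) {V : Vocabulary} {α : Type}
    (P : ∀ n, Table V n → (α → Fin n) → Prop) : Prop :=
  ∃ D : Desc V α, (D.XorFree ∨ par) ∧
    ∀ (n : ℕ) (T : Table V n) (e : α → Fin n), (D.circuit n e).eval T = true ↔ P n T e

namespace Definable

variable {par : Prop} {V : Vocabulary} {α : Type}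

theorem congr {P Q : ∀ n, Table V n → (α → Fin n) → Prop} (h : Definable par P)
    (hPQ : ∀ n T e, P n T e ↔ Q n T e) : Definable par Q := by
  obtain ⟨D, hx, hD⟩ := h
  exact ⟨D, hx, fun n T e => (hD n T e).trans (hPQ n T e)⟩

theorem not {P : ∀ n, Table V n → (α → Fin n) → Prop} (h : Definable par P) :
    Definable par (fun n T e => ¬ P n T e) := by
  obtain ⟨D, hx, hD⟩ := h
  refine ⟨.not D, hx, fun n T e => ?_⟩
  simp [← hD, Desc.circuit, Circuit.eval]

theorem and {P Q : ∀ n, Table V n → (α → Fin n) → Prop} (hP : Definable par P)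
    (hQ : Definable par Q) : Definable par (fun n T e => P n T e ∧ Q n T e) := by
  obtain ⟨D, hx, hD⟩ := hP
  obtain ⟨E, hy, hE⟩ := hQ
  refine ⟨.and D E, ?_, fun n T e => ?_⟩
  · rcases hx with hx | hx
    · rcases hy with hy | hy
      · exact .inl ⟨hx, hy⟩
      · exact .inr hy
    · exact .inr hx
  · simp [← hD, ← hE, Desc.circuit, Circuit.eval, Fin.forall_fin_two]

theorem or {P Q : ∀ n, Table V n → (α → Fin n) → Prop} (hP : Definable par P)
    (hQ : Definable par Q) : Definable par (fun n T e => P n T e ∨ Q n T e) :=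
  (hP.not.and hQ.not).not.congr fun n T e => by tauto

theorem imp {P Q : ∀ n, Table V n → (α → Fin n) → Prop} (hP : Definable par P)
    (hQ : Definable par Q) : Definable par (fun n T e => P n T e → Q n T e) :=
  (hP.not.or hQ).congr fun n T e => by tauto

theorem iff {P Q : ∀ n, Table V n → (α → Fin n) → Prop} (hP : Definable par P)
    (hQ : Definable par Q) : Definable par (fun n T e => P n T e ↔ Q n T e) :=
  ((hP.imp hQ).and (hQ.imp hP)).congr fun n T e => by tauto

theorem all {P : ∀ n, Table V n → Fin n → (α → Fin n) → Prop}
    (h : Definable (α := Option α) par (fun n T e => P n T (e none) (fun a => e (some a)))) :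
    Definable par (fun n T e => ∀ v, P n T v e) := by
  obtain ⟨D, hx, hD⟩ := h
  refine ⟨.bigAnd D, hx, fun n T e => ?_⟩
  simp only [Desc.circuit, Circuit.eval, hD, decide_eq_true_eq]
  rfl

theorem ex {P : ∀ n, Table V n → Fin n → (α → Fin n) → Prop}
    (h : Definable (α := Option α) par (fun n T e => P n T (e none) (fun a => e (some a)))) :
    Definable par (fun n T e => ∃ v, P n T v e) := by
  obtain ⟨D, hx, hD⟩ := h
  refine ⟨.bigOr D, hx, fun n T e => ?_⟩
  simp only [Desc.circuit, Circuit.eval, hD, decide_eq_true_eq]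
  rfl

open Classical in
theorem odd {P : ∀ n, Table V n → Fin n → (α → Fin n) → Prop} (hpar : par)
    (h : Definable (α := Option α) par (fun n T e => P n T (e none) (fun a => e (some a)))) :
    Definable par (fun n T e => Odd (Finset.univ.filter fun v => P n T v e).card) := by
  obtain ⟨D, hx, hD⟩ := h
  refine ⟨.bigXor D, .inr hpar, fun n T e => ?_⟩
  simp only [Desc.circuit, Circuit.eval, decide_eq_true_eq]
  convert Iff.rfl using 4 with v
  exact (hD n T fun o => o.elim v e).symm

theorem lt (x y : α) : Definable (V := V) par (fun _ _ e => e x < e y) :=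
  ⟨.lt x y, .inl trivial, fun n T e => by simp [Desc.circuit, Circuit.eval]⟩

theorem eq (x y : α) : Definable (V := V) par (fun _ _ e => e x = e y) :=
  ⟨.eq x y, .inl trivial, fun n T e => by simp [Desc.circuit, Circuit.eval]⟩

theorem le (x y : α) : Definable (V := V) par (fun _ _ e => e x ≤ e y) :=
  (lt y x).not.congr fun _ _ _ => not_lt

theorem bit (x y : α) :
    Definable (V := V) par (fun _ _ e => (e x : ℕ).testBit (e y : ℕ) = true) :=
  ⟨.bit x y, .inl trivial, fun n T e => by simp [Desc.circuit, Circuit.eval]⟩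

/-- Here `p` does not depend on the table. This is how facts about the fixed templates enter a
description: they are settled outside the circuit. -/
theorem const (p : Prop) : Definable (V := V) (α := α) par (fun _ _ _ => p) := by
  -- Descriptions have no constant symbols; a tautology serves as truth.
  have h : Definable (V := V) (α := α) par (fun n _ _ => ∀ v : Fin n, v = v) := all (eq none none)
  by_cases hp : p
  · exact h.congr fun _ _ _ => by simp [hp]
  · exact h.not.congr fun _ _ _ => by simp [hp]

theorem exFinite {ι : Type*} [Finite ι] {P : ι → ∀ n, Table V n → (α → Fin n) → Prop}
    (h : ∀ i, Definable par (P i)) : Definable par (fun n T e => ∃ i, P i n T e) := by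
  obtain ⟨m, ⟨f⟩⟩ := Finite.exists_equiv_fin ι
  have key : ∀ (m : ℕ) (Q : Fin m → ∀ n, Table V n → (α → Fin n) → Prop),
      (∀ i, Definable par (Q i)) → Definable par (fun n T e => ∃ i, Q i n T e) := by
    intro m
    induction m with
    | zero => exact fun Q _ => (const False).congr fun _ _ _ => by simp
    | succ m ih =>
      exact fun Q hQ => ((hQ 0).or (ih (fun i => Q i.succ) fun i => hQ _)).congr
        fun n T e => (Fin.exists_fin_succ (P := fun i => Q i n T e)).symm
  exact (key m (fun i => P (f.symm i)) fun i => h _).congr fun n T e =>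
    f.symm.exists_congr_left.trans (by simp)

theorem allFinite {ι : Type*} [Finite ι] {P : ι → ∀ n, Table V n → (α → Fin n) → Prop}
    (h : ∀ i, Definable par (P i)) : Definable par (fun n T e => ∀ i, P i n T e) :=
  (exFinite fun i => (h i).not).not.congr fun n T e => by simp

theorem holds₁ {S : Type} {B : Finset BoolFn} (r : InstRel S B) (x : α) :
    Definable (V := instVoc S B) par (fun _ T e => PostLattice.holds₁ T r (e x)) :=
  ⟨.input r (fun _ => x), .inl trivial, fun n T e => by
    simp [Desc.circuit, Circuit.eval, PostLattice.holds₁]⟩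

theorem holds₂ {S : Type} {B : Finset BoolFn} (r : InstRel S B) (x y : α) :
    Definable (V := instVoc S B) par (fun _ T e => PostLattice.holds₂ T r (e x) (e y)) :=
  ⟨.input r (fun i => if (i : ℕ) = 0 then x else y), .inl trivial, fun n T e => by
    simp only [Desc.circuit, Circuit.eval, PostLattice.holds₂, apply_ite e]⟩

end Definable

/-- Definable output relations are computed by a circuit family. -/
theorem exists_circuitMap {par : Prop} {V W : Vocabulary} (k : ℕ)
    (P : ∀ r : W.Rel, ∀ n, Table V n → (Fin (W.arity r) × Fin k → Fin n) → Prop)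
    (h : ∀ r, Definable par (P r)) :
    ∃ F : CircuitMap V W, (F.XorFree ∨ par) ∧ ∃ hk : F.k = k,
      ∀ n (T : Table V n) (z : W.Entry (n ^ k)), F.run T (hk ▸ z) = true ↔
        P z.1 n T (fun ij => finFunctionFinEquiv.symm (z.2 ij.1) ij.2) := by
  choose D hD hP using h
  refine ⟨⟨k, D⟩, ?_, rfl, fun n T z => hP _ _ _ _⟩
  by_cases hpar : par
  · exact .inr hpar
  · exact .inl fun r => (hD r).resolve_right hpar

/-! ### Substitution -/

/-- Substitution of formulae for propositions. -/
def Fml.subst (s : ℕ → Fml) : Fml → Fml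
  | .var k => s k
  | .app c args => .app c fun i => (args i).subst s

theorem Fml.eval_subst (s : ℕ → Fml) (σ : ℕ → Bool) (φ : Fml) :
    (φ.subst s).eval σ = φ.eval fun k => (s k).eval σ := by
  induction φ with
  | var k => rfl
  | app c args ih => simp only [Fml.subst, Fml.eval, ih]

theorem Fml.isOver_subst {B : Set BoolFn} {s : ℕ → Fml} {φ : Fml} (hφ : φ.IsOver B)
    (hs : ∀ k, (s k).IsOver B) : (φ.subst s).IsOver B := by
  induction φ with
  | var k => exact hs k
  | app c args ih => exact ⟨hφ.1, fun i => ih i (hφ.2 i)⟩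

theorem subAt_cons_app (c : BoolFn) (args : Fin c.1 → Fml) (i : Fin c.1) (p : List ℕ) :
    (Fml.app c args).subAt ((i : ℕ) :: p) = (args i).subAt p := by
  simp [Fml.subAt]

theorem subAt_cons_ne_none {φ : Fml} {i : ℕ} {p : List ℕ} (h : φ.subAt (i :: p) ≠ none) :
    ∃ c args, ∃ j : Fin c.1, φ = .app c args ∧ (j : ℕ) = i ∧ (args j).subAt p ≠ none := by
  cases φ with
  | var k => simp [Fml.subAt] at h
  | app c args =>
    by_cases h' : i < c.1
    · exact ⟨c, args, ⟨i, h'⟩, rfl, rfl, by simpa [Fml.subAt, h'] using h⟩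
    · simp [Fml.subAt, h'] at h

theorem subAt_subst_var (s : ℕ → Fml) {φ : Fml} {v : List ℕ} {k : ℕ}
    (h : φ.subAt v = some (.var k)) (p : List ℕ) :
    (φ.subst s).subAt (v ++ p) = (s k).subAt p := by
  induction v generalizing φ with
  | nil => rw [subAt_nil] at h; cases h; rfl
  | cons i v ih =>
    obtain ⟨c, args, j, rfl, rfl, -⟩ := subAt_cons_ne_none (by rw [h]; simp)
    rw [subAt_cons_app] at h
    simpa [Fml.subst, subAt_cons_app] using ih h

theorem subAt_subst_app (s : ℕ → Fml) {φ : Fml} {q : List ℕ} {c : BoolFn}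
    {args : Fin c.1 → Fml} (h : φ.subAt q = some (.app c args)) :
    (φ.subst s).subAt q = some (.app c fun i => (args i).subst s) := by
  induction q generalizing φ with
  | nil => rw [subAt_nil] at h; cases h; rfl
  | cons i v ih =>
    obtain ⟨c, args, j, rfl, rfl, -⟩ := subAt_cons_ne_none (by rw [h]; simp)
    rw [subAt_cons_app] at h
    simpa [Fml.subst, subAt_cons_app] using ih h

/-- The host formula contributes only its connectives, since each of its leaves is overwritten by
the root of what is substituted there. -/
theorem subAt_subst_cases {s : ℕ → Fml} {φ : Fml} {p : List ℕ}
    (h : (φ.subst s).subAt p ≠ none) :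
    (∃ c args, φ.subAt p = some (.app c args)) ∨
      ∃ v p' k, p = v ++ p' ∧ φ.subAt v = some (.var k) ∧ (s k).subAt p' ≠ none := by
  induction p generalizing φ with
  | nil =>
    cases φ with
    | var k => exact .inr ⟨[], [], k, rfl, rfl, h⟩
    | app c args => exact .inl ⟨c, args, rfl⟩
  | cons i p ih =>
    cases φ with
    | var k => exact .inr ⟨[], i :: p, k, rfl, rfl, h⟩
    | app c args =>
      obtain ⟨c', args', j, e, rfl, h'⟩ := subAt_cons_ne_none h
      cases e
      rcases ih h' with ⟨c, a, e⟩ | ⟨v, p', k, rfl, e, h''⟩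
      · exact .inl ⟨c, a, by rw [subAt_cons_app]; exact e⟩
      · exact .inr ⟨j :: v, p', k, rfl, by rw [subAt_cons_app]; exact e, h''⟩

/-- No address runs through a leaf. -/
theorem eq_of_leaf_prefix {φ : Fml} {v q : List ℕ} {k : ℕ} (hv : φ.subAt v = some (.var k))
    (hq : φ.subAt q ≠ none) (h : v <+: q) : q = v := by
  obtain ⟨r, rfl⟩ := h
  rw [subAt_append, hv] at hq
  cases r with
  | nil => simp
  | cons i r => simp [Fml.subAt] at hq

/-! ### Iterated substitution of a template -/

/-- The formula obtained by nesting the template `A` to depth `d`; the innermost propositions,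
named by the words of the labels on the way down, are replaced according to `cont`. -/
def nest (A : Fml) (cont : List ℕ → Fml) : ℕ → List ℕ → Fml
  | 0, l => cont l
  | d + 1, l => A.subst fun k => nest A cont d (l ++ [k])

/-- The leaves of a formula, given by their addresses. -/
abbrev Leaf (A : Fml) : Type := {v : List ℕ // ∃ k, A.subAt v = some (.var k)}

instance (A : Fml) : Finite (Leaf A) :=
  ((subAt_finite A).subset fun v hv => by
    obtain ⟨k, hk⟩ := hv
    simp [hk] : {v | ∃ k, A.subAt v = some (.var k)}.Finite).to_subtype

/-- The number of the proposition at a leaf. -/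
noncomputable def Leaf.label {A : Fml} (v : Leaf A) : ℕ := v.2.choose

theorem Leaf.subAt_val {A : Fml} (v : Leaf A) : A.subAt v.1 = some (.var v.label) := v.2.choose_spec

/-- The address reached by descending along a word of leaves through nested copies of `A`. -/
def wordAddr {A : Fml} (w : List (Leaf A)) : List ℕ := (w.map Subtype.val).flatten

theorem wordAddr_cons {A : Fml} (v : Leaf A) (w : List (Leaf A)) :
    wordAddr (v :: w) = v.1 ++ wordAddr w := by simp [wordAddr]

theorem wordAddr_append {A : Fml} (w w' : List (Leaf A)) :
    wordAddr (w ++ w') = wordAddr w ++ wordAddr w' := by simp [wordAddr]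

/-- The address depends on the leaves passed, but the formula found there depends only on their
labels: a proposition occurring twice in `A` gives two copies of the same subformula. -/
theorem subAt_nest_wordAddr {A : Fml} (cont : List ℕ → Fml) (d : ℕ) (w : List (Leaf A))
    (l q : List ℕ) :
    (nest A cont (d + w.length) l).subAt (wordAddr w ++ q) =
      (nest A cont d (l ++ w.map Leaf.label)).subAt q := by
  induction w generalizing l with
  | nil => simp [wordAddr]
  | cons v w ih =>
    rw [wordAddr_cons, List.append_assoc, List.length_cons, ← add_assoc, nest,
      subAt_subst_var _ v.subAt_val, ih]
    simp

/-- `q` is the address of a connective in `A`. -/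
def IsInner (A : Fml) (q : List ℕ) : Prop := ∃ c args, A.subAt q = some (.app c args)

theorem subAt_nest_cases {A : Fml} {cont : List ℕ → Fml} {d : ℕ} {l p : List ℕ}
    (h : (nest A cont d l).subAt p ≠ none) :
    ∃ (w : List (Leaf A)) (q : List ℕ), p = wordAddr w ++ q ∧
      ((w.length < d ∧ IsInner A q) ∨
        (w.length = d ∧ (cont (l ++ w.map Leaf.label)).subAt q ≠ none)) := by
  induction d generalizing l p with
  | zero => exact ⟨[], p, rfl, .inr ⟨rfl, by simpa [nest] using h⟩⟩
  | succ d ih =>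
    rcases subAt_subst_cases h with h | ⟨v, p', k, rfl, hv, h'⟩
    · exact ⟨[], p, rfl, .inl ⟨by simp, h⟩⟩
    · obtain ⟨w, q, rfl, hw⟩ := ih h'
      have hk : Leaf.label (A := A) ⟨v, k, hv⟩ = k := by
        have := hv.symm.trans (Leaf.subAt_val (A := A) ⟨v, k, hv⟩)
        simp only [Option.some.injEq, Fml.var.injEq] at this
        exact this.symm
      refine ⟨⟨v, k, hv⟩ :: w, q, by simp [wordAddr_cons], ?_⟩
      simpa only [List.length_cons, Nat.add_lt_add_iff_right, Nat.add_right_cancel_iff,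
        List.map_cons, hk, List.append_assoc, List.singleton_append] using hw

theorem IsInner.not_leaf_prefix {A : Fml} {q : List ℕ} (hq : IsInner A q) (v : Leaf A) :
    ¬ v.1 <+: q := by
  intro h
  obtain ⟨c, args, hq⟩ := hq
  have := eq_of_leaf_prefix v.subAt_val (by simp [hq]) h
  rw [this, v.subAt_val] at hq
  cases hq

/-- Leaf addresses form a prefix code, as nothing lies below a leaf. -/
theorem Leaf.eq_of_append_prefix {A : Fml} {v v' : Leaf A} {r r' : List ℕ}
    (h : v.1 ++ r <+: v'.1 ++ r') : v = v' := by
  rcases List.prefix_or_prefix_of_prefix ((List.prefix_append _ _).trans h)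
    (List.prefix_append v'.1 r') with h' | h'
  · exact Subtype.ext (eq_of_leaf_prefix v.subAt_val (by simp [v'.subAt_val]) h').symm
  · exact Subtype.ext (eq_of_leaf_prefix v'.subAt_val (by simp [v.subAt_val]) h')

/-- By the prefix-code property, addresses are compared leaf by leaf. Once the first word is
exhausted, its remainder `q` ends at a connective, so it cannot run past the next leaf `v` of the
other word and must be a prefix of it. The right-hand side mentions only words and positions in
fixed blocks, so that it can be read off the codes. -/
theorem wordAddr_prefix_iff {A : Fml} {d : ℕ} {w w' : List (Leaf A)} {q q' : List ℕ}
    (hw : w.length ≤ d) (hw' : w'.length ≤ d) (hq : w.length < d → IsInner A q)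
    (hq' : w'.length < d → IsInner A q') :
    wordAddr w ++ q <+: wordAddr w' ++ q' ↔
      (w = w' ∧ q <+: q') ∨ ∃ v w₂, w' = w ++ v :: w₂ ∧ q <+: v.1 := by
  induction w generalizing w' d with
  | nil =>
    cases w' with
    | nil => simp [wordAddr]
    | cons v w' =>
      have hq := hq (by simp at hw' ⊢; omega)
      simp only [wordAddr_cons, List.append_assoc]
      constructor
      · intro h
        refine .inr ⟨v, w', rfl, ?_⟩
        exact (List.prefix_or_prefix_of_prefix h (List.prefix_append _ _)).resolve_right
          (hq.not_leaf_prefix v)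
      · rintro (⟨h, -⟩ | ⟨v', w₂, h, h'⟩)
        · cases h
        · cases h
          exact h'.trans (List.prefix_append _ _)
  | cons v w ih =>
    obtain _ | d := d
    · simp at hw
    cases w' with
    | nil =>
      have hq' := hq' (by simp)
      simp only [wordAddr_cons, List.append_assoc]
      constructor
      · intro h
        exact (hq'.not_leaf_prefix v ((List.prefix_append _ _).trans h)).elim
      · simp
    | cons v' w' =>
      have ih := ih (d := d) (w' := w') (by simpa using hw) (by simpa using hw')
        (fun h => hq (by simpa using h)) (fun h => hq' (by simpa using h))
      simp only [wordAddr_cons, List.append_assoc]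
      constructor
      · intro h
        obtain rfl := Leaf.eq_of_append_prefix h
        rw [List.prefix_append_right_inj] at h
        rcases ih.1 h with ⟨rfl, h'⟩ | ⟨u, w₂, rfl, h'⟩
        · exact .inl ⟨rfl, h'⟩
        · exact .inr ⟨u, w₂, rfl, h'⟩
      · rintro (⟨h, h'⟩ | ⟨u, w₂, h, h'⟩)
        · cases h
          rw [List.prefix_append_right_inj]
          exact ih.2 (.inl ⟨rfl, h'⟩)
        · cases h
          rw [List.prefix_append_right_inj]
          exact ih.2 (.inr ⟨u, w₂, rfl, h'⟩)

/-- A child stays in the block of its parent, unless the step arrives at a leaf of the template;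
then it is the root of the block placed there. -/
theorem wordAddr_eq_snoc_iff {A : Fml} {d : ℕ} {w w' : List (Leaf A)} {q q' : List ℕ} {i : ℕ}
    (hA : 0 < d → ∀ k, A ≠ .var k)
    (hw : w.length ≤ d) (hw' : w'.length ≤ d) (hq : w.length < d → IsInner A q)
    (hq' : w'.length < d → IsInner A q') :
    wordAddr w' ++ q' = wordAddr w ++ q ++ [i] ↔
      (w = w' ∧ q' = q ++ [i]) ∨ ∃ v, w' = w ++ [v] ∧ v.1 = q ++ [i] ∧ q' = [] := by
  constructor
  · intro h
    have h1 : wordAddr w ++ q <+: wordAddr w' ++ q' := by rw [h]; exact List.prefix_append _ _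
    rcases (wordAddr_prefix_iff hw hw' hq hq').1 h1 with ⟨rfl, -⟩ | ⟨v, w₂, rfl, hv⟩
    · exact .inl ⟨rfl, by simpa using h⟩
    · have hd : w.length < d := by simp at hw'; omega
      have leaf_ne : ∀ u : Leaf A, u.1 ≠ [] := fun u hu => by
        have := u.subAt_val
        rw [hu, subAt_nil] at this
        exact hA (by omega) _ (Option.some.inj this)
      obtain ⟨r, hr⟩ := hv
      simp only [wordAddr_append, wordAddr_cons, List.append_assoc, List.append_cancel_left_eq,
        ← hr] at h
      cases r with
      | nil => exact ((hq hd).not_leaf_prefix v (by simp [← hr])).elim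
      | cons j r =>
        simp only [List.cons_append, List.cons.injEq, List.append_eq_nil_iff] at h
        obtain ⟨rfl, rfl, h2, rfl⟩ := h
        refine .inr ⟨v, ?_, hr.symm, rfl⟩
        cases w₂ with
        | nil => rfl
        | cons u w₂ =>
          rw [wordAddr_cons, List.append_eq_nil_iff] at h2
          exact (leaf_ne u h2.1).elim
  · rintro (⟨rfl, rfl⟩ | ⟨v, rfl, hv, rfl⟩)
    · simp
    · simp [wordAddr, hv]

/-- Equality is the prefix relation both ways, and two proper extensions contradict each other by
length. -/
theorem wordAddr_injective {A : Fml} {d : ℕ} {w w' : List (Leaf A)} {q q' : List ℕ}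
    (hw : w.length ≤ d) (hw' : w'.length ≤ d) (hq : w.length < d → IsInner A q)
    (hq' : w'.length < d → IsInner A q') (h : wordAddr w ++ q = wordAddr w' ++ q') :
    w = w' ∧ q = q' := by
  rcases (wordAddr_prefix_iff hw hw' hq hq').1 (by rw [h]) with ⟨rfl, -⟩ | ⟨v, w₂, rfl, -⟩
  · exact ⟨rfl, by simpa using h⟩
  · rcases (wordAddr_prefix_iff hw' hw hq' hq).1 (by rw [h]) with ⟨h, -⟩ | ⟨v, w₃, h, -⟩
    · simpa using congrArg List.length h
    · have := congrArg List.length h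
      simp at this

theorem isOver_nest {B : Set BoolFn} {A : Fml} {cont : List ℕ → Fml} (hA : A.IsOver B)
    (hc : ∀ l, (cont l).IsOver B) (d : ℕ) (l : List ℕ) : (nest A cont d l).IsOver B := by
  induction d generalizing l with
  | zero => exact hc l
  | succ d ih => exact Fml.isOver_subst hA fun k => ih _

/-- The value of a nested formula, if the template expresses a product of `r` arguments. -/
theorem eval_nest {M : Type} [CommMonoid M] (ι : Bool → M) {A : Fml} {cont : List ℕ → Fml}
    {r d : ℕ} (hA : 0 < d → ∀ σ, ι (A.eval σ) = ∏ k : Fin r, ι (σ k)) (l : List ℕ)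
    (σ : ℕ → Bool) :
    ι ((nest A cont d l).eval σ) =
      ∏ f : Fin d → Fin r, ι ((cont (l ++ List.ofFn fun j => (f j : ℕ))).eval σ) := by
  induction d generalizing l with
  | zero => simp [nest]
  | succ d ih =>
    rw [nest, Fml.eval_subst, hA (by omega), ← (Fin.consEquiv fun _ => Fin r).prod_comp,
      Fintype.prod_prod_type]
    refine Finset.prod_congr rfl fun k _ => ?_
    rw [ih fun _ => hA (by omega)]
    simp [Fin.consEquiv, List.ofFn_succ]

/-! ### Reading off the relevant propositions of a formula from its table -/

theorem subAt_snoc {φ : Fml} {p : List ℕ} {c : BoolFn} {args : Fin c.1 → Fml}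
    (hp : φ.subAt p = some (.app c args)) (i : Fin c.1) :
    φ.subAt (p ++ [(i : ℕ)]) = some (args i) := by
  rw [subAt_append, hp]
  simp [Fml.subAt, subAt_nil]

/-- `ν` identifies the nodes of the formula `φ` in the table `T`. -/
structure IsNodeMap {S : Type} {B : Finset BoolFn} {n : ℕ} (T : Table (instVoc S B) n)
    (φ : Fml) (ν : List ℕ → Fin n) : Prop where
  inj : ∀ p q, φ.subAt p ≠ none → φ.subAt q ≠ none → ν p = ν q → p = q
  lt : ∀ p k, φ.subAt p = some (.var k) → k < 2 ^ n
  conn : ∀ (c : B) (u : Fin n), holds₁ T (.conn c) u ↔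
    ∃ p args, φ.subAt p = some (.app c.1 args) ∧ ν p = u
  prop : ∀ u : Fin n, holds₁ T .prop u ↔ ∃ p k, φ.subAt p = some (.var k) ∧ ν p = u
  name : ∀ u j : Fin n, holds₂ T .name u j ↔
    ∃ p k, φ.subAt p = some (.var k) ∧ ν p = u ∧ k.testBit (j : ℕ) = true
  arg : ∀ (c : B) (i : Fin c.1.1) (u v : Fin n), holds₂ T (.arg c i) u v ↔
    ∃ p args, φ.subAt p = some (.app c.1 args) ∧ ν p = u ∧ ν (p ++ [(i : ℕ)]) = v
  below : ∀ u v : Fin n, holds₂ T .below u v ↔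
    ∃ p q, φ.subAt p ≠ none ∧ φ.subAt q ≠ none ∧ p <+: q ∧ ν p = u ∧ ν q = v

theorem encodes_iff {S : Type} {B : Finset BoolFn} {n : ℕ} {T : Table (instVoc S B) n}
    {x : List S} {φ : Fml} :
    Encodes B T (x, φ) ↔ 2 ≤ n ∧ φ.IsOver (B : Set BoolFn) ∧ x.length ≤ n ∧
      (∀ (a : S) (i : Fin n), holds₁ T (.letter a) i ↔ x[(i : ℕ)]? = some a) ∧
      ∃ ν, IsNodeMap T φ ν := by
  constructor
  · rintro ⟨h1, h2, h3, h4, ν, i1, i2, i3, i4, i5, i6, i7⟩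
    exact ⟨h1, h2, h3, h4, ν, i1, i2, i3, i4, i5, i6, i7⟩
  · rintro ⟨h1, h2, h3, h4, ν, i1, i2, i3, i4, i5, i6, i7⟩
    exact ⟨h1, h2, h3, h4, ν, i1, i2, i3, i4, i5, i6, i7⟩

section

variable {S : Type} {B : Finset BoolFn} (J : ∀ f : BoolFn, Finset (Fin f.1)) {n : ℕ}

/-- No step on the way from the root to the node `u` goes to an argument outside `J`. -/
def Reach (T : Table (instVoc S B) n) (u : Fin n) : Prop :=
  ∀ (c : B) (i : Fin c.1.1), i ∉ J c.1 → ∀ w v, holds₂ T (.arg c i) w v → ¬ holds₂ T .below v u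

/-- The node `u` is a proposition on which the value of the formula may depend. -/
def RelProp (T : Table (instVoc S B) n) (u : Fin n) : Prop := Reach J T u ∧ holds₁ T .prop u

open Classical in
/-- The number of the proposition at a node. -/
noncomputable def nodeName (T : Table (instVoc S B) n) (u : Fin n) : ℕ :=
  Nat.ofBits fun j : Fin n => decide (holds₂ T .name u j)

open Classical in
/-- The constant contributed by the connective at a node. -/
noncomputable def nodeConst {M : Type} [CommMonoid M] (κ : BoolFn → M)
    (T : Table (instVoc S B) n) (u : Fin n) : M :=
  if Reach J T u then ∏ c : B, if holds₁ T (.conn c) u then κ c.1 else 1 else 1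

open Classical in
/-- The contribution of a node to the value of the formula. -/
noncomputable def nodeValue {M : Type} [CommMonoid M] (κ : BoolFn → M) (val : ℕ → M)
    (T : Table (instVoc S B) n) (u : Fin n) : M :=
  nodeConst J κ T u * if RelProp J T u then val (nodeName T u) else 1

theorem testBit_nodeName (T : Table (instVoc S B) n) (u j : Fin n) :
    (nodeName T u).testBit j = true ↔ holds₂ T .name u j := by
  simp [nodeName, Nat.testBit_ofBits_lt]

theorem nodeName_lt (T : Table (instVoc S B) n) (u : Fin n) : nodeName T u < 2 ^ n :=
  Nat.ofBits_lt_two_pow _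

namespace IsNodeMap

variable {J} {T : Table (instVoc S B) n} {φ : Fml} {ν : List ℕ → Fin n} (hν : IsNodeMap T φ ν)

include hν

theorem nodeName_eq {p : List ℕ} {k : ℕ} (hp : φ.subAt p = some (.var k)) :
    nodeName T (ν p) = k := by
  apply Nat.eq_of_testBit_eq
  intro j
  by_cases hj : j < n
  · rw [Bool.eq_iff_iff, testBit_nodeName T (ν p) ⟨j, hj⟩, hν.name]
    constructor
    · rintro ⟨q, l, hq, e, hb⟩
      obtain rfl := hν.inj _ _ (by simp [hq]) (by simp [hp]) e
      rw [hq] at hp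
      cases hp
      exact hb
    · exact fun hb => ⟨p, k, hp, rfl, hb⟩
  -- Only digits below `n` are listed in the table; both numbers are below `2 ^ n`, so nothing is
  -- lost.
  · push Not at hj
    have h2 : 2 ^ n ≤ 2 ^ j := Nat.pow_le_pow_right (by simp) hj
    rw [Nat.testBit_lt_two_pow ((nodeName_lt T _).trans_le h2),
      Nat.testBit_lt_two_pow ((hν.lt p k hp).trans_le h2)]

theorem not_conn {p : List ℕ} {k : ℕ} (hp : φ.subAt p = some (.var k)) (c : B) :
    ¬ holds₁ T (.conn c) (ν p) := by
  rw [hν.conn]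
  rintro ⟨q, args, hq, e⟩
  obtain rfl := hν.inj _ _ (by simp [hq]) (by simp [hp]) e
  rw [hq] at hp
  cases hp

theorem conn_iff {p : List ℕ} {c : BoolFn} {args : Fin c.1 → Fml}
    (hp : φ.subAt p = some (.app c args)) (c' : B) :
    holds₁ T (.conn c') (ν p) ↔ c'.1 = c := by
  rw [hν.conn]
  constructor
  · rintro ⟨q, args, hq, e⟩
    obtain rfl := hν.inj _ _ (by simp [hq]) (by simp [hp]) e
    rw [hq] at hp
    cases hp
    rfl
  · rintro rfl
    exact ⟨p, args, hp, rfl⟩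

theorem not_prop {p : List ℕ} {c : BoolFn} {args : Fin c.1 → Fml}
    (hp : φ.subAt p = some (.app c args)) : ¬ holds₁ T .prop (ν p) := by
  rw [hν.prop]
  rintro ⟨q, k, hq, e⟩
  obtain rfl := hν.inj _ _ (by simp [hq]) (by simp [hp]) e
  rw [hq] at hp
  cases hp

theorem below_map {p : List ℕ} (hp : φ.subAt p ≠ none) (u : Fin n) :
    holds₂ T .below (ν p) u ↔ ∃ q, φ.subAt q ≠ none ∧ p <+: q ∧ ν q = u := by
  rw [hν.below]
  constructor
  · rintro ⟨p', q, hp', hq, h, e, e'⟩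
    obtain rfl := hν.inj _ _ hp' hp e
    exact ⟨q, hq, h, e'⟩
  · rintro ⟨q, hq, h, e⟩
    exact ⟨p, q, hp, hq, h, rfl, e⟩

theorem below_app {p : List ℕ} {c : BoolFn} {args : Fin c.1 → Fml}
    (hp : φ.subAt p = some (.app c args)) (u : Fin n) :
    holds₂ T .below (ν p) u ↔
      u = ν p ∨ ∃ i : Fin c.1, holds₂ T .below (ν (p ++ [(i : ℕ)])) u := by
  rw [hν.below_map (by simp [hp])]
  constructor
  · rintro ⟨q, hq, ⟨r, rfl⟩, rfl⟩
    cases r with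
    | nil => simp
    | cons i r =>
      right
      have hq' := hq
      rw [subAt_append, hp, Option.bind_some] at hq'
      obtain ⟨c', args', j, e, rfl, h⟩ := subAt_cons_ne_none hq'
      cases e
      refine ⟨j, ?_⟩
      rw [hν.below_map (by simp [subAt_snoc hp])]
      exact ⟨_, hq, ⟨r, by simp⟩, rfl⟩
  · rintro (rfl | ⟨i, h⟩)
    · exact ⟨p, by simp [hp], List.prefix_rfl, rfl⟩
    · rw [hν.below_map (by simp [subAt_snoc hp])] at h
      obtain ⟨q, hq, h, rfl⟩ := h
      exact ⟨q, hq, (List.prefix_append _ _).trans h, rfl⟩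

theorem below_var {p : List ℕ} {k : ℕ} (hp : φ.subAt p = some (.var k)) (u : Fin n) :
    holds₂ T .below (ν p) u ↔ u = ν p := by
  rw [hν.below_map (by simp [hp])]
  constructor
  · rintro ⟨q, hq, h, rfl⟩
    rw [eq_of_leaf_prefix hp hq h]
  · rintro rfl
    exact ⟨p, by simp [hp], List.prefix_rfl, rfl⟩

theorem not_below_snoc {p : List ℕ} {c : BoolFn} {args : Fin c.1 → Fml}
    (hp : φ.subAt p = some (.app c args)) (i : Fin c.1) :
    ¬ holds₂ T .below (ν (p ++ [(i : ℕ)])) (ν p) := by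
  rw [hν.below_map (by simp [subAt_snoc hp])]
  rintro ⟨q, hq, h, e⟩
  obtain rfl := hν.inj _ _ hq (by simp [hp]) e
  simpa using h.length_le

theorem not_below_of_ne {p : List ℕ} {c : BoolFn} {args : Fin c.1 → Fml}
    (hp : φ.subAt p = some (.app c args)) {i j : Fin c.1} (hij : i ≠ j) (u : Fin n)
    (hi : holds₂ T .below (ν (p ++ [(i : ℕ)])) u) :
    ¬ holds₂ T .below (ν (p ++ [(j : ℕ)])) u := by
  rw [hν.below_map (by simp [subAt_snoc hp])] at hi ⊢
  obtain ⟨q, hq, h, rfl⟩ := hi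
  rintro ⟨q', hq', h', e⟩
  obtain rfl := hν.inj _ _ hq' hq e
  have := List.prefix_of_prefix_length_le h h' (by simp)
  rw [List.prefix_append_right_inj] at this
  simp only [List.cons_prefix_cons] at this
  exact hij (Fin.ext this.1)

theorem not_reach {p : List ℕ} {c : BoolFn} (hc : c ∈ B) {args : Fin c.1 → Fml}
    (hp : φ.subAt p = some (.app c args)) {i : Fin c.1} (hi : i ∉ J c) {u : Fin n}
    (hu : holds₂ T .below (ν (p ++ [(i : ℕ)])) u) : ¬ Reach J T u :=
  fun h => h ⟨c, hc⟩ i hi (ν p) _ ((hν.arg _ _ _ _).2 ⟨p, args, hp, rfl, rfl⟩) hu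

theorem reach_nil : Reach J T (ν []) := by
  intro c i _ w v hv hb
  obtain ⟨p, args, hp, -, rfl⟩ := (hν.arg _ _ _ _).1 hv
  rw [hν.below_map (by simp [subAt_snoc hp])] at hb
  obtain ⟨q, hq, h, e⟩ := hb
  obtain rfl := hν.inj _ _ hq (by simp [subAt_nil]) e
  simp at h

theorem reach_snoc {p : List ℕ} {c : BoolFn} {args : Fin c.1 → Fml}
    (hp : φ.subAt p = some (.app c args)) (hr : Reach J T (ν p)) {i : Fin c.1} (hi : i ∈ J c) :
    Reach J T (ν (p ++ [(i : ℕ)])) := by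
  intro c' i' hi' w v hv hb
  obtain ⟨p', args', hp', rfl, rfl⟩ := (hν.arg _ _ _ _).1 hv
  have hs := subAt_snoc hp' i'
  have hb' := hb
  rw [hν.below_map (by simp [hs])] at hb'
  obtain ⟨q, hq, h, e⟩ := hb'
  obtain rfl := hν.inj _ _ hq (by simp [subAt_snoc hp]) e
  -- A forbidden step on the way to the child is either the last step, excluded by `i ∈ J c`, or
  -- already on the way to the parent.
  rcases List.prefix_concat_iff.1 h with h | h
  · simp only [List.append_singleton_inj] at h
    obtain ⟨rfl, hii⟩ := h
    rw [hp] at hp'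
    cases hp'
    exact hi' (Fin.ext hii ▸ hi)
  · exact hr c' i' hi' _ _ hv ((hν.below_map (by simp [hs]) _).2 ⟨p, by simp [hp], h, rfl⟩)

-- The nodes below `p` are `p` itself and the disjoint subtrees of its children. Children outside
-- `J` may be dropped: everything below them is unreachable, where `h` is 1.
open Classical in
theorem prod_below_app {M : Type} [CommMonoid M] {p : List ℕ} {c : BoolFn} (hc : c ∈ B)
    {args : Fin c.1 → Fml} (hp : φ.subAt p = some (.app c args)) {h : Fin n → M}
    (hh : ∀ u, ¬ Reach J T u → h u = 1) :
    ∏ u with holds₂ T .below (ν p) u, h u =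
      h (ν p) * ∏ i ∈ J c, ∏ u with holds₂ T .below (ν (p ++ [(i : ℕ)])) u, h u := by
  have e : (Finset.univ.filter fun u => holds₂ T .below (ν p) u) =
      insert (ν p) (Finset.univ.biUnion fun i : Fin c.1 =>
        Finset.univ.filter fun u => holds₂ T .below (ν (p ++ [(i : ℕ)])) u) := by
    ext u
    simp [hν.below_app hp]
  rw [e, Finset.prod_insert, Finset.prod_biUnion]
  · congr 1
    symm
    refine Finset.prod_subset (Finset.subset_univ _) fun i _ hi => ?_
    refine Finset.prod_eq_one fun u hu => hh u (hν.not_reach hc hp hi ?_)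
    simpa using hu
  · intro i _ j _ hij
    refine Finset.disjoint_left.2 fun u hu => ?_
    simpa using hν.not_below_of_ne hp hij u (by simpa using hu)
  · simpa using fun i => hν.not_below_snoc hp i

-- Reachability of `p` is needed because unreachable nodes are counted with contribution 1 whatever
-- they carry. It passes down to relevant children, and the irrelevant ones drop out of both sides.
open Classical in
theorem eval_eq_prod_below {M : Type} [CommMonoid M] {ι : Bool → M} {κ : BoolFn → M}
    (hJ : ∀ f ∈ B, ∀ a, ι (f.2 a) = κ f * ∏ i ∈ J f, ι (a i))
    (hφ : φ.IsOver (B : Set BoolFn)) (σ : ℕ → Bool) (χ : Fml) (p : List ℕ)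
    (hp : φ.subAt p = some χ) (hr : Reach J T (ν p)) :
    ι (χ.eval σ) =
      ∏ u with holds₂ T .below (ν p) u, nodeValue J κ (fun k => ι (σ k)) T u := by
  induction χ generalizing p with
  | var k =>
    have e : (Finset.univ.filter fun u => holds₂ T .below (ν p) u) = {ν p} := by
      ext u
      simp [hν.below_var hp]
    have hprop : holds₁ T .prop (ν p) := (hν.prop _).2 ⟨p, k, hp, rfl⟩
    rw [e, Finset.prod_singleton]
    simp [nodeValue, nodeConst, RelProp, hr, hprop, hν.not_conn hp, hν.nodeName_eq hp, Fml.eval]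
  | app c args ih =>
    have hc : c ∈ B := by simpa using (isOver_subAt hφ hp).1
    have hone : ∀ u, ¬ Reach J T u → nodeValue J κ (fun k => ι (σ k)) T u = 1 := fun u hu => by
      simp [nodeValue, nodeConst, RelProp, hu]
    have e : nodeValue J κ (fun k => ι (σ k)) T (ν p) = κ c := by
      simp only [nodeValue, nodeConst, RelProp, hr, hν.not_prop hp, hν.conn_iff hp, if_true,
        and_false, if_false, mul_one]
      rw [Finset.prod_eq_single ⟨c, hc⟩] <;> simp
      intro f hf h1 h2
      exact (h1 h2).elim
    rw [hν.prod_below_app hc hp hone, e, Fml.eval, hJ c hc]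
    congr 1
    exact Finset.prod_congr rfl fun i hi =>
      ih i _ (subAt_snoc hp i) (hν.reach_snoc hp hr hi)

/-- The value of a formula is the product of the contributions of its nodes. -/
theorem eval_eq_prod {M : Type} [CommMonoid M] {ι : Bool → M} {κ : BoolFn → M}
    (hJ : ∀ f ∈ B, ∀ a, ι (f.2 a) = κ f * ∏ i ∈ J f, ι (a i))
    (hφ : φ.IsOver (B : Set BoolFn)) (σ : ℕ → Bool) :
    ι (φ.eval σ) = ∏ u, nodeValue J κ (fun k => ι (σ k)) T u := by
  classical
  rw [hν.eval_eq_prod_below hJ hφ σ φ [] (subAt_nil φ) hν.reach_nil]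
  refine Finset.prod_subset (Finset.subset_univ _) fun u _ hu => ?_
  -- Elements outside the subtree of the root are padding; they carry neither connective nor
  -- proposition and contribute 1.
  have hu : ∀ q, φ.subAt q ≠ none → ν q ≠ u := by
    intro q hq e
    apply hu
    simp only [Finset.mem_filter, Finset.mem_univ, true_and]
    exact (hν.below_map (by simp [subAt_nil]) _).2 ⟨q, hq, List.nil_prefix, e⟩
  have h1 : ¬ holds₁ T .prop u := by
    rw [hν.prop]
    rintro ⟨p, k, hp, e⟩
    exact hu p (by simp [hp]) e
  have h2 : ∀ c, ¬ holds₁ T (.conn c) u := by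
    intro c
    rw [hν.conn]
    rintro ⟨p, k, hp, e⟩
    exact hu p (by simp [hp]) e
  simp [nodeValue, nodeConst, RelProp, h1, h2]

/-- With at most one relevant argument per connective, the reachable nodes form a single branch,
which ends in at most one proposition. -/
theorem relProp_subsingleton_below (hJ : ∀ f ∈ B, (J f).card ≤ 1)
    (hφ : φ.IsOver (B : Set BoolFn)) (χ : Fml) (p : List ℕ) (hp : φ.subAt p = some χ)
    {u u' : Fin n} (hu : RelProp J T u) (hu' : RelProp J T u')
    (hb : holds₂ T .below (ν p) u) (hb' : holds₂ T .below (ν p) u') : u = u' := by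
  induction χ generalizing p with
  | var k =>
    rw [hν.below_var hp] at hb hb'
    rw [hb, hb']
  | app c args ih =>
    have hc : c ∈ B := by simpa using (isOver_subAt hφ hp).1
    have step : ∀ u, RelProp J T u → holds₂ T .below (ν p) u →
        ∃ i ∈ J c, holds₂ T .below (ν (p ++ [(i : ℕ)])) u := by
      intro u hu hb
      rcases (hν.below_app hp u).1 hb with rfl | ⟨i, hi⟩
      · exact (hν.not_prop hp hu.2).elim
      · by_contra! h
        exact hν.not_reach hc hp (fun h' => h i h' hi) hi hu.1
    obtain ⟨i, hi, h⟩ := step u hu hb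
    obtain ⟨i', hi', h'⟩ := step u' hu' hb'
    obtain rfl := Finset.card_le_one.1 (hJ c hc) i hi i' hi'
    exact ih i _ (subAt_snoc hp i) h h'

/-- If every connective depends on at most one argument, then a formula depends on at most one
occurrence of a proposition. -/
theorem relProp_subsingleton (hJ : ∀ f ∈ B, (J f).card ≤ 1)
    (hφ : φ.IsOver (B : Set BoolFn)) {u u' : Fin n} (hu : RelProp J T u)
    (hu' : RelProp J T u') : u = u' := by
  have root : ∀ u, RelProp J T u → holds₂ T .below (ν []) u := by
    intro u hu
    obtain ⟨p, k, hp, rfl⟩ := (hν.prop u).1 hu.2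
    exact (hν.below_map (by simp [subAt_nil]) _).2 ⟨p, by simp [hp], List.nil_prefix, rfl⟩
  exact hν.relProp_subsingleton_below hJ hφ φ [] (subAt_nil φ) hu hu' (root u hu) (root u' hu')

end IsNodeMap

end

/-! ### Expressing functions of a clone by formulae -/

/-- The functions expressed by `B`-formulae form a clone containing `B`. -/
theorem exists_formula_of_mem_clone {B : Set BoolFn} {f : BoolFn} (hf : f ∈ clone B) :
    ∃ χ : Fml, χ.IsOver B ∧ ∀ σ : ℕ → Bool, χ.eval σ = f.2 fun i => σ i := by
  refine hf {f | ∃ χ : Fml, χ.IsOver B ∧ ∀ σ : ℕ → Bool, χ.eval σ = f.2 fun i => σ i} ⟨?_, ?_⟩ ?_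
  · exact fun n i => ⟨.var i, trivial, fun σ => rfl⟩
  · rintro m n f g ⟨χ, hχ, hf⟩ hg
    choose ξ hξ hg using hg
    -- Propositions beyond the arity do not affect the value of `χ`, so the default is harmless.
    refine ⟨χ.subst fun k => if h : k < m then ξ ⟨k, h⟩ else .var 0,
      Fml.isOver_subst hχ fun k => ?_, fun σ => ?_⟩
    · by_cases h : k < m
      · simpa [h] using hξ _
      · simp [h, Fml.IsOver]
    · simp [Fml.eval_subst, hf, hg]
  · exact fun f hf => ⟨.app f fun i => .var i, ⟨hf, fun i => trivial⟩, fun σ => rfl⟩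

/-- The translation copies arguments and may blow up the formula. It serves only to obtain finitely
many templates, never to translate the input. -/
theorem exists_equiv_of_subset_clone {B B' : Set BoolFn} (hB : B ⊆ clone B') {φ : Fml}
    (hφ : φ.IsOver B) : ∃ ψ : Fml, ψ.IsOver B' ∧ φ.Equiv ψ := by
  induction φ with
  | var k => exact ⟨.var k, trivial, fun σ => rfl⟩
  | app c args ih =>
    choose ψ hψ he using fun i => ih i (hφ.2 i)
    obtain ⟨χ, hχ, hc⟩ := exists_formula_of_mem_clone (hB hφ.1)
    refine ⟨χ.subst fun k => if h : k < c.1 then ψ ⟨k, h⟩ else .var 0,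
      Fml.isOver_subst hχ fun k => ?_, fun σ => ?_⟩
    · by_cases h : k < c.1
      · simpa [h] using hψ _
      · simp [h, Fml.IsOver]
    · simp [Fml.eval_subst, hc, Fml.eval, he _ σ]

/-! ### Sets of connectives that are products in a two-element monoid -/

/-- Up to the bijection `ι`, the connectives in `B` are products of a constant `κ` and the
arguments in `J`, in a two-element monoid that is either idempotent or (if `par` holds) a group. -/
structure IsProductBase {M : Type} [CommMonoid M] (par : Prop) (ι : Bool ≃ M) (B : Set BoolFn)
    (J : ∀ f : BoolFn, Finset (Fin f.1)) (κ : BoolFn → M) : Prop where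
  apply_eq : ∀ f ∈ B, ∀ a, ι (f.2 a) = κ f * ∏ i ∈ J f, ι (a i)
  mul_self : ((∀ x : M, x * x = x) ∧ ∀ f ∈ B, (J f).Nonempty → κ f = 1) ∨
    ((∀ x : M, x * x = 1) ∧ par)

section

variable {M : Type} [CommMonoid M]

theorem pow_of_mul_self_eq {x : M} (h : x * x = x) {m : ℕ} (hm : m ≠ 0) : x ^ m = x := by
  induction m with
  | zero => exact (hm rfl).elim
  | succ m ih =>
    rcases Nat.eq_zero_or_pos m with rfl | h'
    · simp
    · rw [pow_succ, ih (by omega), h]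

theorem pow_even_of_mul_self {x : M} (h : x * x = 1) {m : ℕ} (hm : Even m) : x ^ m = 1 := by
  obtain ⟨k, rfl⟩ := hm
  rw [pow_add, ← mul_pow, h, one_pow]

theorem pow_odd_of_mul_self {x : M} (h : x * x = 1) {m : ℕ} (hm : Odd m) : x ^ m = x := by
  obtain ⟨k, rfl⟩ := hm
  rw [pow_succ, pow_even_of_mul_self h (even_two_mul k), one_mul]

variable {par : Prop} {ι : Bool ≃ M} {B : Set BoolFn}
  {J : ∀ f : BoolFn, Finset (Fin f.1)} {κ : BoolFn → M}

namespace IsProductBase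

/-- A connective with two relevant arguments expresses the product of three formulae. -/
theorem exists_product_three (h : IsProductBase par ι B J κ) {f : BoolFn} (hf : f ∈ B)
    (hc : 2 ≤ (J f).card) :
    ∃ p : Fml → Fml → Fml → Fml,
      (∀ X Y Z, X.IsOver B → Y.IsOver B → Z.IsOver B → (p X Y Z).IsOver B) ∧
      ∀ X Y Z σ, ι ((p X Y Z).eval σ) = ι (X.eval σ) * ι (Y.eval σ) * ι (Z.eval σ) := by
  classical
  obtain ⟨i, hi, j, hj, hij⟩ := Finset.one_lt_card.1 (show 1 < (J f).card by omega)
  -- Two relevant places receive `X` and `Y`; `Z` fills all others and so counts `(J f).card - 2`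
  -- times.
  let q : Fml → Fml → Fml → Fml := fun X Y Z =>
    .app f fun k => if k = i then X else if k = j then Y else Z
  have hq : ∀ X Y Z, X.IsOver B → Y.IsOver B → Z.IsOver B → (q X Y Z).IsOver B := by
    intro X Y Z hX hY hZ
    refine ⟨hf, fun k => ?_⟩
    dsimp only
    split_ifs <;> assumption
  have hv : ∀ X Y Z σ, ι ((q X Y Z).eval σ) =
      κ f * (ι (X.eval σ) * ι (Y.eval σ) * ι (Z.eval σ) ^ ((J f).card - 2)) := by
    intro X Y Z σ
    simp only [q, Fml.eval]
    rw [h.apply_eq f hf, ← Finset.mul_prod_erase _ _ hi,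
      ← Finset.mul_prod_erase _ _ (Finset.mem_erase.2 ⟨hij.symm, hj⟩)]
    rw [Finset.prod_congr rfl (g := fun _ => ι (Z.eval σ))]
    · simp [hij.symm, Finset.card_erase_of_mem, hi, hj, mul_assoc, Nat.sub_sub]
    · intro k hk
      simp only [Finset.mem_erase] at hk
      simp [hk.1, hk.2.1]
  rcases h.mul_self with ⟨hm, hκ⟩ | ⟨hm, -⟩
  · have hκ := hκ f hf ⟨i, hi⟩
    -- If `f` has just two relevant arguments, the filler is inert and nesting supplies the third
    -- factor; otherwise idempotence reduces the power of the filler to one factor.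
    by_cases h2 : (J f).card - 2 = 0
    · exact ⟨fun X Y Z => q (q X Y X) Z X, fun X Y Z hX hY hZ => hq _ _ _ (hq _ _ _ hX hY hX) hZ hX,
        fun X Y Z σ => by simp [hv, hκ, h2]⟩
    · exact ⟨q, hq, fun X Y Z σ => by simp [hv, hκ, pow_of_mul_self_eq (hm _) h2]⟩
  -- In a group of exponent two, using `f` twice squares `κ f` away. The filler vanishes if its
  -- exponent is even and counts once if it is odd, hence two different nestings.
  · rcases Nat.even_or_odd ((J f).card - 2) with h2 | h2
    · refine ⟨fun X Y Z => q (q X Y X) Z X,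
        fun X Y Z hX hY hZ => hq _ _ _ (hq _ _ _ hX hY hX) hZ hX, fun X Y Z σ => ?_⟩
      simp only [hv, pow_even_of_mul_self (hm _) h2, mul_one]
      rw [← mul_assoc, ← mul_assoc, hm, one_mul]
    · refine ⟨fun X Y Z => q (q X X X) Y Z,
        fun X Y Z hX hY hZ => hq _ _ _ (hq _ _ _ hX hX hX) hY hZ, fun X Y Z σ => ?_⟩
      simp only [hv, pow_odd_of_mul_self (hm _) h2, hm, one_mul]
      rw [← mul_assoc, ← mul_assoc, ← mul_assoc, hm, one_mul]

/-- Five is odd, so the number of bottom positions is odd at every depth, and exceeds the four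
digits that `leafDigit` uses. Building it from products of three avoids the binary product, which
may be inexpressible without a constant. -/
theorem exists_product_five (h : IsProductBase par ι B J κ) {f : BoolFn} (hf : f ∈ B)
    (hc : 2 ≤ (J f).card) :
    ∃ A : Fml, A.IsOver B ∧ ∀ σ, ι (A.eval σ) = ∏ k : Fin 5, ι (σ k) := by
  obtain ⟨p, hp, hv⟩ := h.exists_product_three hf hc
  refine ⟨p (p (.var 0) (.var 1) (.var 2)) (.var 3) (.var 4),
    hp _ _ _ (hp _ _ _ trivial trivial trivial) trivial trivial, fun σ => ?_⟩
  simp [hv, Fml.eval, Fin.prod_univ_five]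

end IsProductBase

theorem ne_var_of_eval_eq_prod {A : Fml} {r : ℕ} (hr : 2 ≤ r)
    (hA : ∀ σ, ι (A.eval σ) = ∏ k : Fin r, ι (σ k)) (m : ℕ) : A ≠ .var m := by
  rintro rfl
  obtain ⟨i, hi⟩ : ∃ i : Fin r, (i : ℕ) ≠ m := by
    by_contra! h
    have := (h ⟨0, by omega⟩).trans (h ⟨1, by omega⟩).symm
    simp at this
  -- All propositions are neutral except the `i`-th: the product is then not neutral, whereas
  -- proposition `m` is.
  have := hA fun k => if k = i then ι.symm 1 |>.not else ι.symm 1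
  rw [Finset.prod_eq_single i] at this
  · simp only [Fml.eval, hi.symm, if_false, if_true] at this
    simpa using ι.injective this
  · intro j _ hj
    simp [Fin.ext_iff.not.1 hj]
  · simp

open Classical in
/-- How to fill the leaves of a balanced product: the first function is for the relevant
propositions, the second one for padding. The argument `g` gives the value of the formula if all
propositions have the same value. -/
noncomputable def leafFunctions (M : Type) [CommMonoid M] (g : Bool → Bool) :
    (Bool → Bool) × (Bool → Bool) :=
  if ∀ x : M, x * x = x then (g, g) else if g false = g true then (id, g) else (g, id)

theorem leafFunctions_mem (g : Bool → Bool) :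
    ((leafFunctions M g).1 = id ∨ (leafFunctions M g).1 = g) ∧
      ((leafFunctions M g).2 = id ∨ (leafFunctions M g).2 = g) := by
  unfold leafFunctions
  split_ifs <;> simp

/-- Here `R` collects the relevant positions among `N`. In the idempotent case `g` is applied
everywhere, and padding repeats a relevant proposition, which is absorbed. In a group, if `R.card`
is even then `g` is the constant `C`, and an odd number of padding positions contributes `C` once.
If it is odd then `g` multiplies by `C`; the relevant positions contribute `C` an odd number of
times, and the even number of equal padding factors cancels. The test `g false = g true` in
`leafFunctions` detects this parity. -/
theorem IsProductBase.prod_leafFunctions (h : IsProductBase par ι B J κ) {α : Type}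
    (R : Finset α) (y : α → Bool) (z : Bool) (C : M) (N : ℕ) (g : Bool → Bool)
    (hg : ∀ b, ι (g b) = C * ι b ^ R.card) (hz : R.Nonempty → ∃ i ∈ R, y i = z)
    (hN : Odd N) (hR : R.card ≤ N) :
    C * ∏ i ∈ R, ι (y i) =
      (∏ i ∈ R, ι ((leafFunctions M g).1 (y i))) * ι ((leafFunctions M g).2 z) ^ (N - R.card) := by
  classical
  by_cases hm : ∀ x : M, x * x = x
  · simp only [leafFunctions, hm, implies_true, if_true, hg, Finset.prod_mul_distrib,
      Finset.prod_const]
    rcases R.eq_empty_or_nonempty with rfl | hne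
    -- Without relevant propositions `C` comes from padding alone, which exists because `N` is odd.
    · simp [pow_of_mul_self_eq (hm C) hN.pos.ne']
    · have hc : R.card ≠ 0 := hne.card_pos.ne'
      obtain ⟨i, hi, rfl⟩ := hz hne
      have hprod : (∏ i ∈ R, ι (y i)) * ι (y i) = ∏ i ∈ R, ι (y i) := by
        rw [← Finset.mul_prod_erase _ _ hi, mul_right_comm, hm]
      rw [Finset.prod_congr rfl fun j _ => pow_of_mul_self_eq (hm (ι (y j))) hc,
        pow_of_mul_self_eq (hm C) hc, pow_of_mul_self_eq (hm (ι (y i))) hc]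
      rcases Nat.eq_zero_or_pos (N - R.card) with h0 | h0
      · simp [h0]
      · rw [pow_of_mul_self_eq (hm _) h0.ne', mul_mul_mul_comm, hm, hprod]
  · have hm' := (h.mul_self.resolve_left fun h => hm h.1).1
    simp only [leafFunctions, hm, if_false]
    rcases Nat.even_or_odd R.card with he | ho
    · have hg' : ∀ b, ι (g b) = C := fun b => by
        rw [hg, pow_even_of_mul_self (hm' _) he, mul_one]
      have : g false = g true := ι.injective (by rw [hg', hg'])
      simp only [this, if_true, id, hg']
      rw [pow_odd_of_mul_self (hm' _) (Nat.Odd.sub_even hR hN he), mul_comm]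
    · have hg' : ∀ b, ι (g b) = C * ι b := fun b => by
        rw [hg, pow_odd_of_mul_self (hm' _) ho]
      have : ¬ g false = g true := by
        intro e
        have e := congrArg ι e
        rw [hg', hg'] at e
        have e := congrArg (C * ·) e
        simp only [← mul_assoc, hm', one_mul] at e
        simpa using ι.injective e
      simp only [this, if_false, id, hg', Finset.prod_mul_distrib, Finset.prod_const]
      rw [pow_odd_of_mul_self (hm' _) ho, pow_even_of_mul_self (hm' _) (Nat.Odd.sub_odd hN ho),
        mul_one]

end

/-! ### Definable functions with finitely many values -/

/-- All the level sets of `f` are definable. -/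
def DefinableFun (par : Prop) {V : Vocabulary} {α M : Type}
    (f : ∀ n, Table V n → (α → Fin n) → M) : Prop :=
  ∀ m, Definable par fun n T e => f n T e = m

namespace DefinableFun

variable {par : Prop} {V : Vocabulary} {α M : Type}

theorem const (m : M) : DefinableFun (V := V) (α := α) par (fun _ _ _ => m) :=
  fun _ => Definable.const _

theorem ite {P : ∀ n, Table V n → (α → Fin n) → Prop} {_ : ∀ n T e, Decidable (P n T e)}
    {f g : ∀ n, Table V n → (α → Fin n) → M} (hP : Definable par P) (hf : DefinableFun par f)
    (hg : DefinableFun par g) :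
    DefinableFun par (fun n T e => if P n T e then f n T e else g n T e) := fun m =>
  ((hP.and (hf m)).or (hP.not.and (hg m))).congr fun n T e => by
    by_cases h : P n T e <;> simp [h]

theorem comp [Finite M] {M' : Type} (F : M → M') {f : ∀ n, Table V n → (α → Fin n) → M}
    (hf : DefinableFun par f) : DefinableFun par (fun n T e => F (f n T e)) := fun m =>
  (Definable.exFinite fun x => (Definable.const (F x = m)).and (hf x)).congr fun n T e => by
    simp

theorem prodMk {M' : Type} {f : ∀ n, Table V n → (α → Fin n) → M}
    {g : ∀ n, Table V n → (α → Fin n) → M'} (hf : DefinableFun par f) (hg : DefinableFun par g) :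
    DefinableFun par (fun n T e => (f n T e, g n T e)) := fun m =>
  ((hf m.1).and (hg m.2)).congr fun n T e => by simp [Prod.ext_iff]

theorem mul [Finite M] [CommMonoid M] {f g : ∀ n, Table V n → (α → Fin n) → M}
    (hf : DefinableFun par f) (hg : DefinableFun par g) :
    DefinableFun par (fun n T e => f n T e * g n T e) :=
  (hf.prodMk hg).comp fun x => x.1 * x.2

theorem prodFinset [Finite M] [CommMonoid M] {β : Type} (s : Finset β)
    {f : β → ∀ n, Table V n → (α → Fin n) → M} (hf : ∀ b, DefinableFun par (f b)) :
    DefinableFun par (fun n T e => ∏ b ∈ s, f b n T e) := by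
  classical
  induction s using Finset.induction_on with
  | empty => simpa using const 1
  | insert b s hb ih => simpa [Finset.prod_insert hb] using (hf b).mul ih

/-- Products over the universe are definable for a two-element monoid that is either idempotent
or a group of order two; the latter needs parity. -/
theorem prodUniv [CommMonoid M] (ι : Bool ≃ M)
    (hM : (∀ x : M, x * x = x) ∨ ((∀ x : M, x * x = 1) ∧ par))
    {f : ∀ n, Table V n → Fin n → (α → Fin n) → M}
    (hf : DefinableFun (α := Option α) par
      (fun n T e => f n T (e none) (fun a => e (some a)))) :
    DefinableFun par (fun n T e => ∏ v, f n T v e) := by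
  classical
  have two : ∀ x y : M, x ≠ 1 → y ≠ 1 → x = y := by
    intro x y hx hy
    obtain ⟨x, rfl⟩ := ι.surjective x
    obtain ⟨y, rfl⟩ := ι.surjective y
    obtain ⟨o, ho⟩ := ι.surjective 1
    rw [← ho] at hx hy
    have hx : x ≠ o := fun h => hx (by rw [h])
    have hy : y ≠ o := fun h => hy (by rw [h])
    revert hx hy
    cases x <;> cases y <;> cases o <;> simp
  have key : Definable par (fun n T e => ∏ v, f n T v e = 1) := by
    rcases hM with hM | ⟨hM, hp⟩
    -- An idempotent product absorbs each of its factors, so it is 1 only if all of them are.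
    · refine (Definable.all (P := fun n T v e => f n T v e = 1) (hf 1)).congr fun n T e => ?_
      constructor
      · exact fun h => Finset.prod_eq_one fun v _ => h v
      · intro h v
        have e1 : f n T v e * ∏ w, f n T w e = ∏ w, f n T w e := by
          rw [← Finset.mul_prod_erase _ _ (Finset.mem_univ v), ← mul_assoc, hM]
        simpa [h] using e1
    -- There is only one value other than 1; the product is a power of it, decided by the parity of
    -- the exponent.
    · refine (Definable.odd (P := fun n T v e => f n T v e ≠ 1) hp (hf 1).not).not.congr
        fun n T e => ?_
      have hsq : ∀ v w, f n T v e ≠ 1 → f n T w e ≠ 1 → f n T v e = f n T w e :=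
        fun v w => two _ _
      rw [Nat.not_odd_iff_even]
      suffices h : Even (Finset.univ.filter fun v => f n T v e ≠ 1).card ↔
          ∏ v, f n T v e = 1 by convert h
      rw [← Finset.prod_filter_ne_one]
      rcases (Finset.univ.filter fun v => f n T v e ≠ 1).eq_empty_or_nonempty with h0 | ⟨w, hw⟩
      · simp [h0]
      · have hw : f n T w e ≠ 1 := by simpa using hw
        rw [Finset.prod_congr rfl fun v hv => hsq v w (by simpa using hv) hw, Finset.prod_const]
        constructor
        · exact fun h => pow_even_of_mul_self (hM _) h
        · intro h
          by_contra ho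
          rw [pow_odd_of_mul_self (hM _) (Nat.not_even_iff_odd.1 ho)] at h
          exact hw h
  intro m
  by_cases hm : m = 1
  · rw [hm]
    exact key
  · refine key.not.congr fun n T e => ⟨fun h => two _ _ h hm, fun h h' => hm (h ▸ h')⟩

end DefinableFun

/-! ### The output formula: a balanced product -/

section Addresses

variable (A : Fml) (K : (Bool → Bool) → Fml)

/-- The building blocks of the output formula: the product template, and a formula for every
unary function that may appear at the bottom. -/
def block : Option (Bool → Bool) → Fml
  | none => A
  | some g => K g

/-- The positions in the building blocks, where the leaves of the product template are left out,
as they are replaced by other blocks. -/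
abbrev Tag : Type :=
  {τ : Option (Bool → Bool) × List ℕ //
    (block A K τ.1).subAt τ.2 ≠ none ∧ (τ.1 = none → IsInner A τ.2)}

instance : Finite (Tag A K) := by
  have : (⋃ b, (fun q => (b, q)) '' {q | (block A K b).subAt q ≠ none}).Finite :=
    Set.finite_iUnion fun b => (subAt_finite _).image _
  refine (this.subset fun τ hτ => ?_ : {τ : Option (Bool → Bool) × List ℕ |
    (block A K τ.1).subAt τ.2 ≠ none ∧ (τ.1 = none → IsInner A τ.2)}.Finite).to_subtype
  simp only [Set.mem_iUnion]
  exact ⟨τ.1, τ.2, hτ.1, rfl⟩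

variable {A K} (kind : List ℕ → Bool → Bool) (name : List ℕ → ℕ)

/-- The part of the output formula below a bottom position. -/
def bottom (K : (Bool → Bool) → Fml) (l : List ℕ) : Fml :=
  (K (kind l)).subst fun _ => .var (name l)

/-- The word `w` of leaves together with the tag `τ` is a node of the product of depth `d`. -/
def Fits (d : ℕ) (w : List (Leaf A)) (τ : Tag A K) : Prop :=
  match τ.1.1 with
  | none => w.length < d
  | some g => w.length = d ∧ kind (w.map Leaf.label) = g

variable {kind name} {d : ℕ} {w w' : List (Leaf A)} {τ τ' : Tag A K}

theorem Fits.length_le (h : Fits kind d w τ) : w.length ≤ d := by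
  unfold Fits at h
  split at h <;> omega

theorem Fits.block_eq (h : Fits kind d w τ) :
    τ.1.1 = if w.length < d then none else some (kind (w.map Leaf.label)) := by
  unfold Fits at h
  split at h
  · rw [if_pos h]
    assumption
  · rw [if_neg (by omega), h.2]
    assumption

theorem Fits.isInner (h : Fits kind d w τ) (hw : w.length < d) : IsInner A τ.1.2 := by
  unfold Fits at h
  split at h
  · exact τ.2.2 ‹_›
  · omega

theorem Fits.subAt_eq (h : Fits kind d w τ) :
    (∃ l, (nest A (bottom kind name K) d []).subAt (wordAddr w ++ τ.1.2) =
      (A.subst l).subAt τ.1.2 ∧ τ.1.1 = none) ∨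
    ((nest A (bottom kind name K) d []).subAt (wordAddr w ++ τ.1.2) =
      ((block A K τ.1.1).subst fun _ => .var (name (w.map Leaf.label))).subAt τ.1.2) := by
  have hle := h.length_le
  obtain ⟨e, rfl⟩ : ∃ e, d = e + w.length := ⟨d - w.length, by omega⟩
  rw [subAt_nest_wordAddr]
  unfold Fits at h
  split at h
  · obtain ⟨e, rfl⟩ : ∃ e', e = e' + 1 := ⟨e - 1, by omega⟩
    exact .inl ⟨_, rfl, ‹_›⟩
  · obtain rfl : e = 0 := by omega
    right
    rename_i g hg
    simp [nest, bottom, hg, block, h.2]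

/-- The connective at a node depends on the tag alone. It is a fact about fixed blocks, so the
circuits need not compute it. -/
theorem Fits.subAt_app_iff (h : Fits kind d w τ) (c : BoolFn) :
    (∃ args, (nest A (bottom kind name K) d []).subAt (wordAddr w ++ τ.1.2) =
      some (.app c args)) ↔ ∃ args, (block A K τ.1.1).subAt τ.1.2 = some (.app c args) := by
  obtain ⟨l, hl⟩ : ∃ l, (nest A (bottom kind name K) d []).subAt (wordAddr w ++ τ.1.2) =
      ((block A K τ.1.1).subst l).subAt τ.1.2 ∧
      (τ.1.1 = none ∨ ∀ k, l k = .var (name (w.map Leaf.label))) := by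
    rcases h.subAt_eq (name := name) with ⟨l, hl, hn⟩ | hl
    · exact ⟨l, by rw [hl, hn]; rfl, .inl hn⟩
    · exact ⟨_, hl, .inr fun _ => rfl⟩
  rw [hl.1]
  obtain ⟨χ, hχ⟩ := Option.ne_none_iff_exists'.1 τ.2.1
  cases χ with
  | app c' args' =>
    rw [subAt_subst_app _ hχ, hχ]
    simp only [Option.some.injEq, Fml.app.injEq]
    constructor
    · rintro ⟨a, rfl, -⟩
      exact ⟨_, rfl, HEq.rfl⟩
    · rintro ⟨a, rfl, -⟩
      exact ⟨_, rfl, HEq.rfl⟩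
  | var k =>
    have hv : ∀ k, l k = .var (name (w.map Leaf.label)) := by
      refine hl.2.resolve_left fun hn => ?_
      obtain ⟨c', args', h'⟩ := τ.2.2 hn
      rw [hn] at hχ
      change A.subAt _ = _ at hχ
      rw [h'] at hχ
      cases hχ
    have := subAt_subst_var l hχ []
    rw [List.append_nil] at this
    rw [this, hχ, hv, subAt_nil]
    simp

/-- Propositions survive only in bottom blocks, and all those of one block are renamed to the same
proposition. -/
theorem Fits.subAt_var_iff (h : Fits kind d w τ) (k : ℕ) :
    (nest A (bottom kind name K) d []).subAt (wordAddr w ++ τ.1.2) = some (.var k) ↔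
      (∃ k', (block A K τ.1.1).subAt τ.1.2 = some (.var k')) ∧
        k = name (w.map Leaf.label) := by
  obtain ⟨χ, hχ⟩ := Option.ne_none_iff_exists'.1 τ.2.1
  cases χ with
  | app c args =>
    obtain ⟨a, ha⟩ := (h.subAt_app_iff (name := name) c).2 ⟨args, hχ⟩
    rw [ha, hχ]
    simp
  | var k' =>
    rcases h.subAt_eq (name := name) with ⟨l, hl, hn⟩ | hl
    · obtain ⟨c', args', h'⟩ := τ.2.2 hn
      rw [hn] at hχ
      change A.subAt _ = _ at hχ
      rw [h'] at hχ
      cases hχ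
    · have := subAt_subst_var (fun _ => .var (name (w.map Leaf.label))) hχ []
      rw [List.append_nil, subAt_nil] at this
      rw [hl, this, hχ]
      simp [eq_comm]

theorem Fits.subAt_ne_none (h : Fits kind d w τ) :
    (nest A (bottom kind name K) d []).subAt (wordAddr w ++ τ.1.2) ≠ none := by
  obtain ⟨χ, hχ⟩ := Option.ne_none_iff_exists'.1 τ.2.1
  cases χ with
  | app c args =>
    obtain ⟨a, ha⟩ := (h.subAt_app_iff (name := name) c).2 ⟨args, hχ⟩
    simp [ha]
  | var k' =>
    simp [(h.subAt_var_iff (name := name) _).2 ⟨⟨k', hχ⟩, rfl⟩]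

/-- With `Fits.addr_injective`, this puts the nodes of the output formula in bijection with the
fitting pairs of a word and a tag. -/
theorem exists_fits {p : List ℕ} (h : (nest A (bottom kind name K) d []).subAt p ≠ none) :
    ∃ (w : List (Leaf A)) (τ : Tag A K), Fits kind d w τ ∧ wordAddr w ++ τ.1.2 = p := by
  obtain ⟨w, q, rfl, ⟨hw, hq⟩ | ⟨hw, hq⟩⟩ := subAt_nest_cases h
  · obtain ⟨c, args, h'⟩ := id hq
    refine ⟨w, ⟨(none, q), ?_, fun _ => hq⟩, hw, rfl⟩
    simp [block, h']
  · refine ⟨w, ⟨(some (kind (w.map Leaf.label)), q), ?_, by simp⟩, ⟨hw, rfl⟩, rfl⟩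
    simp only [List.nil_append, bottom] at hq
    rcases subAt_subst_cases hq with ⟨c, args, hv⟩ | ⟨v, p', k, rfl, hv, h'⟩
    · simp [block, hv]
    · cases p' with
      | nil => simp [block, hv]
      | cons i p' => simp [Fml.subAt] at h'

theorem Fits.addr_injective (h : Fits kind d w τ) (h' : Fits kind d w' τ')
    (e : wordAddr w ++ τ.1.2 = wordAddr w' ++ τ'.1.2) : w = w' ∧ τ = τ' := by
  obtain ⟨rfl, hq⟩ := wordAddr_injective h.length_le h'.length_le h.isInner h'.isInner e
  refine ⟨rfl, Subtype.ext (Prod.ext ?_ hq)⟩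
  rw [h.block_eq, h'.block_eq]

end Addresses

/-! ### Coding the nodes of the output formula by tuples -/

section Codes

variable (deep : Prop) {A : Fml} {K : (Bool → Bool) → Fml} {n : ℕ}

open Classical in
/-- The depth of the balanced product; it is trivial unless `deep` holds. -/
noncomputable def treeDepth (n : ℕ) : ℕ := if deep then Nat.log 2 n else 0

/-- First-order expression of `j < treeDepth deep n`. -/
def IsLevel (j : Fin n) : Prop :=
  deep ∧ ∃ a : Fin n, ∀ i : Fin n, i ≤ j → (a : ℕ).testBit (i : ℕ) = true

/-- For `deep`, `j` is below the logarithm exactly if `2 ^ (j + 1) - 1` is an element, and this is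
the least number whose binary digits `0, …, j` are all 1. -/
theorem isLevel_iff (j : Fin n) : IsLevel deep j ↔ (j : ℕ) < treeDepth deep n := by
  have hn : n ≠ 0 := by have := j.2; omega
  by_cases hd : deep
  · simp only [IsLevel, hd, true_and, treeDepth, if_true]
    rw [← Nat.succ_le_iff, Nat.le_log_iff_pow_le (by simp) hn]
    constructor
    · rintro ⟨a, ha⟩
      have : (a : ℕ) % 2 ^ (j + 1 : ℕ) = 2 ^ (j + 1 : ℕ) - 1 := by
        apply Nat.eq_of_testBit_eq
        intro i
        rw [Nat.testBit_mod_two_pow, Nat.testBit_two_pow_sub_one]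
        by_cases hi : i < j + 1
        · have := ha ⟨i, by omega⟩ (Fin.mk_le_of_le_val (by omega))
          simpa [hi] using this
        · simp [hi]
      have h1 := Nat.mod_le (a : ℕ) (2 ^ (j + 1 : ℕ))
      have h2 := a.2
      have h3 : 0 < 2 ^ (j + 1 : ℕ) := by positivity
      simp only [Nat.succ_eq_add_one]
      omega
    · intro h
      have h3 : 0 < 2 ^ (j + 1 : ℕ) := by positivity
      simp only [Nat.succ_eq_add_one] at h
      refine ⟨⟨2 ^ (j + 1 : ℕ) - 1, by omega⟩, fun i hi => ?_⟩
      have : (i : ℕ) ≤ j := hi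
      simp only [Nat.testBit_two_pow_sub_one, decide_eq_true_eq]
      omega
  · simp [IsLevel, hd, treeDepth]

/-- This is why a set of levels fits into a single element, as its binary expansion. -/
theorem two_pow_treeDepth_le (hn : n ≠ 0) : 2 ^ treeDepth deep n ≤ n := by
  unfold treeDepth
  split_ifs
  · exact Nat.pow_log_le_self 2 hn
  · simpa using Nat.one_le_iff_ne_zero.2 hn

theorem treeDepth_lt (hn : n ≠ 0) : treeDepth deep n < n :=
  lt_of_lt_of_le Nat.lt_two_pow_self (two_pow_treeDepth_le deep hn)

variable (A K) in
/-- The digits of the code of a node: its level, the set of levels at which the way to the node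
goes through a given leaf of the template, and the tag in unary. -/
abbrev Digit : Type := Option (Leaf A ⊕ Tag A K)

/-- The digits `t` code the word `w`. -/
def CodesWord (w : List (Leaf A)) (t : Digit A K → Fin n) : Prop :=
  (t none : ℕ) = w.length ∧
    ∀ (v : Leaf A) (j : ℕ), (t (some (.inl v)) : ℕ).testBit j = true ↔ w[j]? = some v

/-- The digits `t` code the tag `τ`. -/
def CodesTag (τ : Tag A K) (t : Digit A K → Fin n) : Prop :=
  ∀ τ', (τ' = τ → ∀ y, y ≤ t (some (.inr τ'))) ∧ (τ' ≠ τ → ∀ y, t (some (.inr τ')) ≤ y)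

/-- First-order expression of the fact that `t` codes some word. -/
def IsWordCode (t : Digit A K → Fin n) : Prop :=
  ∀ j : Fin n,
    (j < t none → IsLevel deep j ∧ ∃ v : Leaf A, (t (some (.inl v)) : ℕ).testBit (j : ℕ) = true ∧
      ∀ v' : Leaf A, (t (some (.inl v')) : ℕ).testBit (j : ℕ) = true → v' = v) ∧
    (¬ j < t none → ∀ v : Leaf A, ¬ (t (some (.inl v)) : ℕ).testBit (j : ℕ) = true)

theorem isWordCode_iff (t : Digit A K → Fin n) :
    IsWordCode deep t ↔ ∃ w, w.length ≤ treeDepth deep n ∧ CodesWord w t := by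
  constructor
  · intro h
    have h1 : ∀ j : Fin (t none), ∃ v : Leaf A, ∀ v' : Leaf A,
        (t (some (.inl v')) : ℕ).testBit (j : ℕ) = true ↔ v' = v := by
      intro j
      obtain ⟨-, v, hv, hu⟩ := (h ⟨j, j.2.trans (t none).2⟩).1 j.2
      exact ⟨v, fun v' => ⟨hu v', fun e => e ▸ hv⟩⟩
    choose f hf using h1
    refine ⟨List.ofFn f, ?_, by simp, fun v j => ?_⟩
    · rw [List.length_ofFn]
      -- If the word were too long, the number `treeDepth deep n`, which is an element, would have
      -- to be a level.
      by_contra! hlt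
      have hd := treeDepth_lt deep (n := n) (by have := (t none).2; omega)
      have := ((h ⟨treeDepth deep n, hd⟩).1 hlt).1
      rw [isLevel_iff] at this
      simp at this
    · by_cases hj : j < t none
      · simp only [List.getElem?_ofFn, hj, dif_pos, Option.some.injEq]
        rw [hf ⟨j, hj⟩ v, eq_comm]
      · simp only [List.getElem?_ofFn, hj, dif_neg, not_false_eq_true, reduceCtorEq, iff_false]
        by_cases hjn : j < n
        · exact (h ⟨j, hjn⟩).2 hj v
        · rw [Nat.testBit_lt_two_pow]
          · simp
          · exact (t (some (.inl v))).2.trans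
              (Nat.lt_two_pow_self.trans_le (Nat.pow_le_pow_right (by simp) (by omega)))
  · rintro ⟨w, hw, hl, h⟩ j
    refine ⟨fun hj => ?_, fun hj v => ?_⟩
    · have hj : (j : ℕ) < w.length := by rw [← hl]; exact hj
      refine ⟨(isLevel_iff deep j).2 (by omega), w[(j : ℕ)], ?_, fun v' hv' => ?_⟩
      · rw [h, List.getElem?_eq_getElem hj]
      · rw [h, List.getElem?_eq_getElem hj] at hv'
        exact (Option.some.inj hv').symm
    · have hj : ¬ (j : ℕ) < w.length := by rw [← hl]; exact hj
      rw [h, List.getElem?_eq_none (by omega)]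
      simp

theorem exists_code (hn : n ≠ 0) {w : List (Leaf A)} (hw : w.length ≤ treeDepth deep n)
    (τ : Tag A K) : ∃ t : Digit A K → Fin n, CodesWord w t ∧ CodesTag τ t := by
  classical
  have h1 := treeDepth_lt deep hn
  have h2 := two_pow_treeDepth_le deep hn
  refine ⟨fun
    | none => ⟨w.length, by omega⟩
    | some (.inl v) => ⟨Nat.ofBits fun j : Fin (treeDepth deep n) => decide (w[(j : ℕ)]? = some v),
        (Nat.ofBits_lt_two_pow _).trans_le h2⟩
    | some (.inr τ') => if τ' = τ then ⟨n - 1, by omega⟩ else ⟨0, by omega⟩, ⟨rfl, ?_⟩, ?_⟩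
  · intro v j
    by_cases hj : j < treeDepth deep n
    · simp [Nat.testBit_ofBits_lt _ _ hj]
    · simp only [Nat.testBit_ofBits_ge _ _ (not_lt.1 hj)]
      rw [List.getElem?_eq_none (by omega)]
      simp
  · intro τ'
    refine ⟨fun h y => ?_, fun h y => ?_⟩
    · simp only [h, if_true]
      exact Fin.mk_le_mk.2 (by have := y.2; omega)
    · simp only [h, if_false]
      exact Fin.mk_le_mk.2 (Nat.zero_le _)

variable {w w' : List (Leaf A)} {τ τ' : Tag A K} {t t' : Digit A K → Fin n}

theorem CodesWord.ext (h : CodesWord w t) (h' : CodesWord w' t) : w = w' := by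
  apply List.ext_getElem?
  intro j
  apply Option.ext
  exact fun v => (h.2 v j).symm.trans (h'.2 v j)

theorem CodesTag.ext (hn : 2 ≤ n) (h : CodesTag τ t) (h' : CodesTag τ' t) : τ = τ' := by
  by_contra hne
  -- Tags are marked by the maximum against the minimum, which differ since `2 ≤ n`.
  have h1 := (h τ).1 rfl ⟨n - 1, by omega⟩
  have h2 := (h' τ).2 hne ⟨0, by omega⟩
  have := Fin.mk_le_mk.1 (h1.trans h2)
  omega

theorem CodesWord.same_iff (h : CodesWord w t) (h' : CodesWord w' t') :
    (t none = t' none ∧ ∀ v : Leaf A, t (some (.inl v)) = t' (some (.inl v))) ↔ w = w' := by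
  constructor
  · rintro ⟨h1, h2⟩
    exact h.ext ⟨h1 ▸ h'.1, fun v => h2 v ▸ h'.2 v⟩
  · rintro rfl
    refine ⟨Fin.ext (h.1.trans h'.1.symm), fun v => Fin.ext (Nat.eq_of_testBit_eq fun j => ?_)⟩
    rw [Bool.eq_iff_iff, h.2, h'.2]

theorem code_unique (h : CodesWord w t) (ht : CodesTag τ t) (h' : CodesWord w t')
    (ht' : CodesTag τ t') : t = t' := by
  obtain ⟨h1, h2⟩ := (h.same_iff h').2 rfl
  funext x
  rcases x with _ | v | τ₁
  · exact h1
  · exact h2 v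
  · by_cases e : τ₁ = τ
    · exact le_antisymm ((ht' τ₁).1 e _) ((ht τ₁).1 e _)
    · exact le_antisymm ((ht τ₁).2 e _) ((ht' τ₁).2 e _)

/-- First-order expression of the fact that the word of `t'` extends that of `t`, and continues
with the leaf `v`. -/
def ExtendsBy (v : Leaf A) (t t' : Digit A K → Fin n) : Prop :=
  t none < t' none ∧
    (∀ j : Fin n, j < t none → ∀ v' : Leaf A, (t (some (.inl v')) : ℕ).testBit (j : ℕ) = true ↔
      (t' (some (.inl v')) : ℕ).testBit (j : ℕ) = true) ∧
    (t' (some (.inl v)) : ℕ).testBit (t none : ℕ) = true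

theorem CodesWord.extendsBy_iff (h : CodesWord w t) (h' : CodesWord w' t') (v : Leaf A) :
    ExtendsBy v t t' ↔ ∃ w₂, w' = w ++ v :: w₂ := by
  constructor
  · rintro ⟨h1, h2, h3⟩
    rw [h'.2, h.1] at h3
    rw [Fin.lt_def, h.1, h'.1] at h1
    refine ⟨w'.drop (w.length + 1), ?_⟩
    have e : w'.take w.length = w := by
      apply List.ext_getElem?
      intro j
      by_cases hj : j < w.length
      · rw [List.getElem?_take_of_lt hj]
        apply Option.ext
        intro v'
        have hjn : j < n := by have := h.1; have := (t none).2; omega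
        have := h2 ⟨j, hjn⟩ (by rw [Fin.lt_def, h.1]; exact hj) v'
        rw [h.2, h'.2] at this
        exact this.symm
      · rw [List.getElem?_eq_none (by simp; omega), List.getElem?_eq_none (by omega)]
    have e' : w'.drop w.length = v :: w'.drop (w.length + 1) := by
      rw [List.drop_eq_getElem_cons h1]
      rw [List.getElem?_eq_getElem h1] at h3
      rw [Option.some.inj h3]
    rw [← e', ← List.take_append_drop w.length w', e]
    simp
  · rintro ⟨w₂, rfl⟩
    refine ⟨?_, fun j hj v' => ?_, ?_⟩
    · rw [Fin.lt_def, h.1, h'.1]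
      simp
    · rw [Fin.lt_def, h.1] at hj
      rw [h.2, h'.2, List.getElem?_append_left hj]
    · rw [h'.2, h.1]
      simp

end Codes

/-! ### The output formula is equivalent to the input formula -/

section Leaves

variable (deep : Prop) {n : ℕ}

open Classical in
/-- The labels on the way to the bottom position that is reserved for the element `i`: they are
the binary digits of `i`, where the leading one is joined to the last one. -/
noncomputable def leafDigit (i j : Fin n) : ℕ :=
  if (∀ z, j ≤ z) ∧ ∃ d : Fin n, ¬ IsLevel deep d ∧ (i : ℕ).testBit (d : ℕ) = true then
    if (i : ℕ).testBit (j : ℕ) = true then 3 else 2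
  else if (i : ℕ).testBit (j : ℕ) = true then 1 else 0

theorem leafDigit_lt (i j : Fin n) : leafDigit deep i j < 5 := by
  unfold leafDigit
  split_ifs <;> simp

-- A number below `n` has up to `Nat.log 2 n + 1` binary digits, one more than there are levels. The
-- parity of each label gives the digit of its level; the label at level 0 is at least 2 exactly if
-- the leading digit is 1. Level 0 exists because `2 ≤ n`.
variable {deep} in
theorem eq_of_leafDigit_eq (hd : deep) (hn : 2 ≤ n) {i i' : Fin n}
    (h : ∀ j : Fin n, IsLevel deep j → leafDigit deep i j = leafDigit deep i' j) : i = i' := by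
  have hD : treeDepth deep n = Nat.log 2 n := by simp [treeDepth, hd]
  have hDn := treeDepth_lt deep (n := n) (by omega)
  have hpos : 0 < Nat.log 2 n := Nat.log_pos (by simp) hn
  have hbit : ∀ j : Fin n, IsLevel deep j → (i : ℕ).testBit j = (i' : ℕ).testBit j := by
    intro j hj
    have := h j hj
    unfold leafDigit at this
    rw [Bool.eq_iff_iff]
    split_ifs at this <;> simp_all
  have htop : ∀ i : Fin n, (∃ d : Fin n, ¬ IsLevel deep d ∧ (i : ℕ).testBit (d : ℕ) = true) ↔
      (i : ℕ).testBit (Nat.log 2 n) = true := by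
    intro i
    constructor
    · rintro ⟨d, hd', hb⟩
      rw [isLevel_iff, hD, not_lt] at hd'
      rcases hd'.eq_or_lt with e | hlt
      · rw [e]
        exact hb
      · rw [Nat.testBit_lt_two_pow] at hb
        · simp at hb
        · exact i.2.trans ((Nat.lt_pow_succ_log_self (by simp) n).trans_le
            (Nat.pow_le_pow_right (by simp) hlt))
    · intro hb
      refine ⟨⟨Nat.log 2 n, by omega⟩, ?_, hb⟩
      rw [isLevel_iff, hD]
      simp
  have htop' : (i : ℕ).testBit (Nat.log 2 n) = (i' : ℕ).testBit (Nat.log 2 n) := by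
    have := h ⟨0, by omega⟩ ((isLevel_iff _ _).2 (by simpa [hD] using hpos))
    unfold leafDigit at this
    have hz : ∀ z : Fin n, (⟨0, by omega⟩ : Fin n) ≤ z := fun z => Fin.mk_le_of_le_val (Nat.zero_le _)
    simp only [hz, implies_true, true_and, htop] at this
    rw [Bool.eq_iff_iff]
    split_ifs at this <;> simp_all
  apply Fin.ext
  apply Nat.eq_of_testBit_eq
  intro j
  rcases lt_trichotomy j (Nat.log 2 n) with hj | rfl | hj
  · exact hbit ⟨j, by omega⟩ ((isLevel_iff _ _).2 (by simpa [hD] using hj))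
  · exact htop'
  · have : ∀ i : Fin n, (i : ℕ).testBit j = false := fun i => by
      rw [Nat.testBit_lt_two_pow]
      exact i.2.trans ((Nat.lt_pow_succ_log_self (by simp) n).trans_le
            (Nat.pow_le_pow_right (by simp) hj))
    rw [this, this]

variable {S : Type} {B : Finset BoolFn} (J : ∀ f : BoolFn, Finset (Fin f.1))
  {M : Type} [CommMonoid M] (ι : Bool ≃ M) (κ : BoolFn → M)

/-- The bottom position `l` of the output formula is reserved for the relevant proposition at the
node `i`. -/
def Hit (T : Table (instVoc S B) n) (l : List ℕ) (i : Fin n) : Prop :=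
  RelProp J T i ∧ ∀ j : Fin n, IsLevel deep j → l[(j : ℕ)]? = some (leafDigit deep i j)

/-- The node `s` is the least relevant proposition. -/
def FirstRelProp (T : Table (instVoc S B) n) (s : Fin n) : Prop :=
  RelProp J T s ∧ ∀ s', RelProp J T s' → s ≤ s'

/-- The value of the formula if all propositions have the value `b`. -/
noncomputable def commonValue (T : Table (instVoc S B) n) (b : Bool) : Bool :=
  ι.symm (∏ u, nodeValue J κ (fun _ => ι b) T u)

open Classical in
/-- The function applied at a bottom position. -/
noncomputable def leafKind (T : Table (instVoc S B) n) (l : List ℕ) : Bool → Bool :=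
  if ∃ i, Hit deep J T l i then (leafFunctions M (commonValue J ι κ T)).1
  else (leafFunctions M (commonValue J ι κ T)).2

open Classical in
/-- The number of the proposition used at a bottom position. -/
noncomputable def leafName (T : Table (instVoc S B) n) (l : List ℕ) : ℕ :=
  if h : ∃ i, Hit deep J T l i then nodeName T h.choose
  else if h : ∃ s, FirstRelProp J T s then nodeName T h.choose else 0

variable {deep J ι κ}

theorem FirstRelProp.eq {T : Table (instVoc S B) n} {s s' : Fin n} (h : FirstRelProp J T s)
    (h' : FirstRelProp J T s') : s = s' :=
  le_antisymm (h.2 s' h'.1) (h'.2 s h.1)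

/-- For `deep`, the labels determine the element; otherwise there are no levels, but at most one
relevant proposition competes for the only position. -/
theorem Hit.eq (hdeep : deep ↔ ∃ f ∈ B, 2 ≤ (J f).card)
    {T : Table (instVoc S B) n} {φ : Fml} {ν : List ℕ → Fin n} (hν : IsNodeMap T φ ν)
    (hφ : φ.IsOver (B : Set BoolFn)) (hn : 2 ≤ n) {l : List ℕ} {i i' : Fin n}
    (h : Hit deep J T l i) (h' : Hit deep J T l i') : i = i' := by
  by_cases hd : deep
  · exact eq_of_leafDigit_eq hd hn fun j hj => Option.some.inj ((h.2 j hj).symm.trans (h'.2 j hj))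
  · refine hν.relProp_subsingleton (fun f hf => ?_) hφ h.1 h'.1
    by_contra! hlt
    exact hd (hdeep.2 ⟨f, hf, hlt⟩)

/-- The output formula is equivalent to the input formula. -/
theorem equiv_nest {par : Prop} (hB : IsProductBase par ι (B : Set BoolFn) J κ)
    (hdeep : deep ↔ ∃ f ∈ B, 2 ≤ (J f).card) {T : Table (instVoc S B) n} {φ : Fml}
    {ν : List ℕ → Fin n} (hν : IsNodeMap T φ ν) (hφ : φ.IsOver (B : Set BoolFn)) (hn : 2 ≤ n)
    {A : Fml} (hA : deep → ∀ σ, ι (A.eval σ) = ∏ k : Fin 5, ι (σ k))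
    {K : (Bool → Bool) → Fml}
    (hK : ∀ g, (g = id ∨ g = fun b => φ.eval fun _ => b) → ∀ b, (K g).eval (fun _ => b) = g b) :
    φ.Equiv (nest A (bottom (leafKind deep J ι κ T) (leafName deep J T) K)
      (treeDepth deep n) []) := by
  classical
  intro σ
  apply ι.injective
  set D := treeDepth deep n with hD
  have hDn : D < n := treeDepth_lt deep (by omega)
  have hDdeep : 0 < D → deep := fun h => by
    by_contra hd
    simp [hD, treeDepth, hd] at h
  let R : Finset (Fin n) := Finset.univ.filter fun u => RelProp J T u
  let C : M := ∏ u, nodeConst J κ T u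
  have hval : ∀ val : ℕ → M, ∏ u, nodeValue J κ val T u = C * ∏ u ∈ R, val (nodeName T u) := by
    intro val
    simp only [nodeValue, Finset.prod_mul_distrib, C, R, Finset.prod_filter]
  let g := commonValue J ι κ T
  have hg : ∀ b, ι (g b) = C * ι b ^ R.card := fun b => by
    simp [g, commonValue, hval]
  -- This ties `commonValue`, which is computed from the table, to a `B`-formula, so that a block
  -- for it is available.
  have hg' : g = fun b => φ.eval fun _ => b := by
    funext b
    apply ι.injective
    rw [hν.eval_eq_prod hB.apply_eq hφ]
    simp [g, commonValue]
  have hkind : ∀ l b, (K (leafKind deep J ι κ T l)).eval (fun _ => b) =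
      leafKind deep J ι κ T l b := by
    intro l
    apply hK
    rw [← hg']
    unfold leafKind
    split_ifs
    · exact (leafFunctions_mem _).1
    · exact (leafFunctions_mem _).2
  -- A block is filled with a single proposition throughout, so only its values under constant
  -- assignments matter.
  have hbot : ∀ l, (bottom (leafKind deep J ι κ T) (leafName deep J T) K l).eval σ =
      leafKind deep J ι κ T l (σ (leafName deep J T l)) := by
    intro l
    rw [bottom, Fml.eval_subst]
    exact hkind l _
  let pos : Fin n → Fin D → Fin 5 := fun i j => ⟨leafDigit deep i ⟨j, by omega⟩, leafDigit_lt _ _ _⟩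
  have hhit : ∀ (f : Fin D → Fin 5) i,
      Hit deep J T ([] ++ List.ofFn fun j => (f j : ℕ)) i ↔ i ∈ R ∧ pos i = f := by
    intro f i
    simp only [Hit, R, Finset.mem_filter, Finset.mem_univ, true_and, List.nil_append,
      List.getElem?_ofFn, isLevel_iff]
    refine and_congr_right fun _ => ⟨fun h => ?_, ?_⟩
    · funext j
      have := h ⟨j, by omega⟩ j.2
      simp only [j.2, dif_pos, Option.some.injEq] at this
      exact Fin.ext this.symm
    · rintro rfl j hj
      have hj : (j : ℕ) < D := hj
      simp [pos, hj]
  have hinj : Set.InjOn pos R := by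
    intro i hi i' hi' e
    exact Hit.eq hdeep hν hφ hn ((hhit _ i).2 ⟨hi, rfl⟩) ((hhit _ i').2 ⟨hi', e.symm⟩)
  have hcard : (R.image pos).card = R.card := Finset.card_image_of_injOn hinj
  let z : Bool := if h : ∃ s, FirstRelProp J T s then σ (nodeName T h.choose) else σ 0
  have hz : R.Nonempty → ∃ i ∈ R, σ (nodeName T i) = z := by
    intro hR
    have hfirst : FirstRelProp J T (R.min' hR) :=
      ⟨by simpa [R] using R.min'_mem hR, fun s' hs' => R.min'_le s' (by simpa [R] using hs')⟩
    have h : ∃ s, FirstRelProp J T s := ⟨_, hfirst⟩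
    refine ⟨h.choose, by simpa [R] using h.choose_spec.1, ?_⟩
    simp only [z, h, dif_pos]
  have hN : R.card ≤ 5 ^ D := by
    rw [← hcard]
    exact (Finset.card_le_univ _).trans (by simp)
  -- The `5 ^ D` bottom positions split into the image of `pos`, one for each relevant node, and the
  -- padding.
  rw [eval_nest ι (fun h => hA (hDdeep h)), hν.eval_eq_prod hB.apply_eq hφ, hval,
    hB.prod_leafFunctions R (fun u => σ (nodeName T u)) z C (5 ^ D) g hg hz
      (Odd.pow (by decide)) hN,
    ← Finset.prod_mul_prod_compl (R.image pos), Finset.prod_image hinj]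
  congr 1
  · refine Finset.prod_congr rfl fun i hi => ?_
    have h : ∃ i', Hit deep J T ([] ++ List.ofFn fun j => (pos i j : ℕ)) i' :=
      ⟨i, (hhit _ i).2 ⟨hi, rfl⟩⟩
    have hc : h.choose = i :=
      Hit.eq hdeep hν hφ hn h.choose_spec ((hhit _ i).2 ⟨hi, rfl⟩)
    rw [hbot]
    simp only [leafKind, leafName, h, if_true, dif_pos, hc, g]
  · rw [Finset.prod_congr rfl (g := fun _ => ι ((leafFunctions M g).2 z)), Finset.prod_const,
      Finset.card_compl, hcard]
    · simp
    · intro f hf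
      have h : ¬ ∃ i', Hit deep J T ([] ++ List.ofFn fun j => (f j : ℕ)) i' := by
        rintro ⟨i, hi⟩
        rw [hhit] at hi
        simp only [Finset.mem_compl, Finset.mem_image, not_exists, not_and] at hf
        exact hf i hi.1 hi.2
      rw [hbot]
      simp only [leafKind, leafName, h, if_false, dif_neg, not_false_eq_true, g, z]
      split_ifs <;> rfl

end Leaves

/-! ### The relations of the output table -/

section Output

variable (deep : Prop) {n : ℕ} {S : Type} {B B' : Finset BoolFn}
  (J : ∀ f : BoolFn, Finset (Fin f.1)) {M : Type} [CommMonoid M] (ι : Bool ≃ M) (κ : BoolFn → M)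
  {A : Fml} {K : (Bool → Bool) → Fml}

/-- First-order expression of `Hit` for a word that is given by its code. -/
def HitCode (T : Table (instVoc S B) n) (t : Digit A K → Fin n) (i : Fin n) : Prop :=
  RelProp J T i ∧ ∀ j : Fin n, IsLevel deep j → ∃ v : Leaf A,
    (t (some (.inl v)) : ℕ).testBit (j : ℕ) = true ∧ leafDigit deep i j = v.label

open Classical in
/-- The function applied at a bottom position that is given by its code. -/
noncomputable def kindCode (T : Table (instVoc S B) n) (t : Digit A K → Fin n) : Bool → Bool :=
  if ∃ i, HitCode deep J T t i then (leafFunctions M (commonValue J ι κ T)).1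
  else (leafFunctions M (commonValue J ι κ T)).2

/-- The binary digits of the proposition used at a bottom position that is given by its code. -/
def NameCode (T : Table (instVoc S B) n) (t : Digit A K → Fin n) (j : Fin n) : Prop :=
  (∃ i, HitCode deep J T t i ∧ holds₂ T .name i j) ∨
    ((¬ ∃ i, HitCode deep J T t i) ∧ ∃ s, FirstRelProp J T s ∧ holds₂ T .name s j)

/-- The tuple `t` codes a node of the output formula with the tag `τ`. -/
def IsNode (τ : Tag A K) (T : Table (instVoc S B) n) (t : Digit A K → Fin n) : Prop :=
  IsWordCode deep t ∧ CodesTag τ t ∧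
    match τ.1.1 with
    | none => IsLevel deep (t none)
    | some g => ¬ IsLevel deep (t none) ∧ kindCode deep J ι κ T t = g

variable {deep J ι κ} {w : List (Leaf A)} {τ : Tag A K} {T : Table (instVoc S B) n}
  {t : Digit A K → Fin n}

theorem CodesWord.hitCode_iff (h : CodesWord w t) (i : Fin n) :
    HitCode deep J T t i ↔ Hit deep J T (w.map Leaf.label) i := by
  refine and_congr_right fun _ => forall₂_congr fun j _ => ?_
  simp only [h.2, List.getElem?_map, Option.map_eq_some_iff]
  exact exists_congr fun v => and_congr_right fun _ => eq_comm

theorem CodesWord.kindCode_eq (h : CodesWord w t) :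
    kindCode deep J ι κ T t = leafKind deep J ι κ T (w.map Leaf.label) := by
  have : (∃ i, HitCode deep J T t i) ↔ ∃ i, Hit deep J T (w.map Leaf.label) i :=
    exists_congr h.hitCode_iff
  by_cases h' : ∃ i, Hit deep J T (w.map Leaf.label) i <;> simp [kindCode, leafKind, this, h']

/-- `leafName` picks a witness by choice; uniqueness lets an existential quantifier read the digits
of that same witness. -/
theorem CodesWord.nameCode_iff (h : CodesWord w t)
    (huniq : ∀ l i i', Hit deep J T l i → Hit deep J T l i' → i = i') (j : Fin n) :
    NameCode deep J T t j ↔ (leafName deep J T (w.map Leaf.label)).testBit (j : ℕ) = true := by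
  simp only [NameCode, leafName, h.hitCode_iff]
  by_cases h1 : ∃ i, Hit deep J T (w.map Leaf.label) i
  · simp only [h1, not_true_eq_false, false_and, or_false, dif_pos, testBit_nodeName]
    constructor
    · rintro ⟨i, hi, hb⟩
      rwa [huniq _ _ _ h1.choose_spec hi]
    · exact fun hb => ⟨_, h1.choose_spec, hb⟩
  · have h1' : ¬ ∃ i, Hit deep J T (w.map Leaf.label) i ∧ holds₂ T .name i j :=
      fun ⟨i, hi, _⟩ => h1 ⟨i, hi⟩
    simp only [h1, h1', not_false_eq_true, true_and, false_or, dif_neg]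
    by_cases h2 : ∃ s, FirstRelProp J T s
    · simp only [h2, dif_pos, testBit_nodeName]
      constructor
      · rintro ⟨i, hi, hb⟩
        rwa [h2.choose_spec.eq hi]
      · exact fun hb => ⟨_, h2.choose_spec, hb⟩
    · have h2' : ¬ ∃ s, FirstRelProp J T s ∧ holds₂ T .name s j := fun ⟨i, hi, _⟩ => h2 ⟨i, hi⟩
      simp [h2, h2']

theorem isNode_iff : IsNode deep J ι κ τ T t ↔
    ∃ w, CodesWord w t ∧ CodesTag τ t ∧
      Fits (leafKind deep J ι κ T) (treeDepth deep n) w τ := by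
  unfold IsNode Fits
  rw [isWordCode_iff]
  constructor
  · rintro ⟨⟨w, hw, h⟩, hτ, hl⟩
    refine ⟨w, h, hτ, ?_⟩
    rw [isLevel_iff, h.1, h.kindCode_eq] at hl
    generalize τ.1.1 = b at hl ⊢
    cases b with
    | none => exact hl
    | some g => exact ⟨by omega, hl.2⟩
  · rintro ⟨w, h, hτ, hl⟩
    rw [isLevel_iff, h.1, h.kindCode_eq]
    refine ⟨⟨w, ?_, h⟩, hτ, ?_⟩
    · split at hl <;> omega
    · generalize τ.1.1 = b at hl ⊢
      cases b with
      | none => exact hl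
      | some g => exact ⟨by omega, hl.2⟩

variable (deep J ι κ) (A K)

/-- The output relations, in terms of the digits of the elements. The number `o` is the position of
the least significant digit. -/
def outRel {k : ℕ} (ε : Digit A K ≃ Fin k) (o : Fin k) (r : InstRel S B') (n : ℕ)
    (T : Table (instVoc S B) n) (e : Fin ((instVoc S B').arity r) × Fin k → Fin n) : Prop :=
  match r with
  -- An output element is below `n` exactly if all its digits but the least significant vanish;
  -- letters keep their positions.
  | .letter a => (∀ i : Fin k, i ≠ o → ∀ y, e ((0 : Fin 1), i) ≤ y) ∧
      holds₁ T (.letter a) (e ((0 : Fin 1), o))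
  | .conn c => ∃ τ : Tag A K, (∃ args, (block A K τ.1.1).subAt τ.1.2 = some (.app c.1 args)) ∧
      IsNode deep J ι κ τ T fun x => e ((0 : Fin 1), ε x)
  | .prop => ∃ τ : Tag A K, (∃ m, (block A K τ.1.1).subAt τ.1.2 = some (.var m)) ∧
      IsNode deep J ι κ τ T fun x => e ((0 : Fin 1), ε x)
  | .name => ∃ τ : Tag A K, (∃ m, (block A K τ.1.1).subAt τ.1.2 = some (.var m)) ∧
      IsNode deep J ι κ τ T (fun x => e ((0 : Fin 2), ε x)) ∧
      (∀ i : Fin k, i ≠ o → ∀ y, e ((1 : Fin 2), i) ≤ y) ∧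
      NameCode deep J T (fun x : Digit A K => e ((0 : Fin 2), ε x)) (e ((1 : Fin 2), o))
  | .arg c i => ∃ τ τ' : Tag A K,
      (∃ args, (block A K τ.1.1).subAt τ.1.2 = some (.app c.1 args)) ∧
      IsNode deep J ι κ τ T (fun x => e ((0 : Fin 2), ε x)) ∧
      IsNode deep J ι κ τ' T (fun x => e ((1 : Fin 2), ε x)) ∧
      ((τ'.1.2 = τ.1.2 ++ [(i : ℕ)] ∧ e ((0 : Fin 2), ε none) = e ((1 : Fin 2), ε none) ∧
        ∀ v, e ((0 : Fin 2), ε (some (.inl v))) = e ((1 : Fin 2), ε (some (.inl v)))) ∨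
      ∃ v : Leaf A, (v.1 = τ.1.2 ++ [(i : ℕ)] ∧ τ'.1.2 = []) ∧
        ExtendsBy (K := K) v (fun x => e ((0 : Fin 2), ε x)) (fun x => e ((1 : Fin 2), ε x)) ∧
        ∀ z, e ((0 : Fin 2), ε none) < z → e ((1 : Fin 2), ε none) ≤ z)
  | .below => ∃ τ τ' : Tag A K,
      IsNode deep J ι κ τ T (fun x => e ((0 : Fin 2), ε x)) ∧
      IsNode deep J ι κ τ' T (fun x => e ((1 : Fin 2), ε x)) ∧
      ((τ.1.2 <+: τ'.1.2 ∧ e ((0 : Fin 2), ε none) = e ((1 : Fin 2), ε none) ∧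
        ∀ v, e ((0 : Fin 2), ε (some (.inl v))) = e ((1 : Fin 2), ε (some (.inl v)))) ∨
      ∃ v : Leaf A, τ.1.2 <+: v.1 ∧
        ExtendsBy (K := K) v (fun x => e ((0 : Fin 2), ε x)) (fun x => e ((1 : Fin 2), ε x)))

end Output

/-! ### Definability of the output relations -/

namespace Definable

variable {par : Prop} {α : Type}

section

variable {V : Vocabulary} (deep : Prop)

theorem isLevel (x : α) : Definable (V := V) par (fun _ _ e => IsLevel deep (e x)) :=
  (const deep).and (ex (all ((le _ _).imp (bit _ _))))

theorem leafDigit (x y : α) :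
    DefinableFun (V := V) par (fun _ _ e => leafDigit deep (e x) (e y)) :=
  .ite ((all (le _ _)).and (ex ((isLevel deep _).not.and (bit _ _))))
    (.ite (bit _ _) (.const _) (.const _)) (.ite (bit _ _) (.const _) (.const _))

variable {A : Fml} {K : (Bool → Bool) → Fml}

theorem isWordCode (f : Digit A K → α) :
    Definable (V := V) par (fun _ _ e => IsWordCode deep fun x => e (f x)) :=
  all (((lt _ _).imp ((isLevel deep _).and (exFinite fun _ => (bit _ _).and
    (allFinite fun _ => (bit _ _).imp (const _))))).and
    ((lt _ _).not.imp (allFinite fun _ => (bit _ _).not)))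

theorem codesTag (τ : Tag A K) (f : Digit A K → α) :
    Definable (V := V) par (fun _ _ e => CodesTag τ fun x => e (f x)) :=
  allFinite fun _ => ((const _).imp (all (le _ _))).and ((const _).imp (all (le _ _)))

theorem extendsBy (v : Leaf A) (f f' : Digit A K → α) :
    Definable (V := V) par (fun _ _ e => ExtendsBy v (fun x => e (f x)) fun x => e (f' x)) :=
  (lt _ _).and ((all ((lt _ _).imp (allFinite fun _ => (bit _ _).iff (bit _ _)))).and (bit _ _))

end

variable {S : Type} {B B' : Finset BoolFn} (J : ∀ f : BoolFn, Finset (Fin f.1))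

theorem reach (x : α) : Definable par (fun _ (T : Table (instVoc S B) _) e => Reach J T (e x)) :=
  allFinite fun _ => allFinite fun _ => (const _).imp
    (all (all ((holds₂ _ _ _).imp (holds₂ _ _ _).not)))

theorem relProp (x : α) :
    Definable par (fun _ (T : Table (instVoc S B) _) e => RelProp J T (e x)) :=
  (reach J _).and (holds₁ _ _)

theorem firstRelProp (x : α) :
    Definable par (fun _ (T : Table (instVoc S B) _) e => FirstRelProp J T (e x)) :=
  (relProp J _).and (all ((relProp J _).imp (le _ _)))

variable {M : Type} [CommMonoid M] {ι : Bool ≃ M} {κ : BoolFn → M} {J}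

/-- This is the only place where a parity gate can enter the reduction. -/
theorem commonValue (hB : IsProductBase par ι (B : Set BoolFn) J κ) :
    DefinableFun (α := α) par (fun _ (T : Table (instVoc S B) _) _ => commonValue J ι κ T) := by
  have : Finite M := Finite.of_equiv _ ι
  have h : ∀ b, DefinableFun (α := α) par
      (fun _ (T : Table (instVoc S B) _) _ => PostLattice.commonValue J ι κ T b) := fun b => by
    refine .comp ι.symm (.prodUniv ι (hB.mul_self.imp_left And.left) ?_)
    exact .mul (.ite (reach J _) (.prodFinset _ fun _ => .ite (holds₁ _ _) (.const _) (.const _))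
      (.const _)) (.ite (relProp J _) (.const _) (.const _))
  exact fun g => ((h false (g false)).and (h true (g true))).congr fun n T e =>
    Bool.forall_bool.symm.trans funext_iff.symm

variable (deep : Prop) {A : Fml} {K : (Bool → Bool) → Fml}

theorem hitCode (f : Digit A K → α) (y : α) :
    Definable par (fun _ (T : Table (instVoc S B) _) e =>
      HitCode deep J T (fun x => e (f x)) (e y)) :=
  (relProp J _).and (all ((isLevel deep _).imp (exFinite fun _ => (bit _ _).and
    (leafDigit deep _ _ _))))

theorem kindCode (hB : IsProductBase par ι (B : Set BoolFn) J κ) (f : Digit A K → α) :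
    DefinableFun par (fun _ (T : Table (instVoc S B) _) e =>
      kindCode deep J ι κ T fun x => e (f x)) :=
  .ite (ex (hitCode deep _ _)) (.comp (fun g => (leafFunctions M g).1) (commonValue hB))
    (.comp (fun g => (leafFunctions M g).2) (commonValue hB))

theorem nameCode (f : Digit A K → α) (y : α) :
    Definable par (fun _ (T : Table (instVoc S B) _) e =>
      NameCode deep J T (fun x => e (f x)) (e y)) :=
  (ex ((hitCode deep _ _).and (holds₂ _ _ _))).or
    ((ex (hitCode deep _ _)).not.and (ex ((firstRelProp J _).and (holds₂ _ _ _))))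

theorem isNode (hB : IsProductBase par ι (B : Set BoolFn) J κ) (τ : Tag A K)
    (f : Digit A K → α) :
    Definable par (fun _ (T : Table (instVoc S B) _) e =>
      IsNode deep J ι κ τ T fun x => e (f x)) := by
  unfold IsNode
  refine (isWordCode deep _).and ((codesTag τ _).and ?_)
  split
  · exact isLevel deep _
  · exact (isLevel deep _).not.and (kindCode deep hB f _)

theorem outRel (hB : IsProductBase par ι (B : Set BoolFn) J κ) {k : ℕ} (ε : Digit A K ≃ Fin k)
    (o : Fin k) (r : InstRel S B') :
    Definable par (outRel (B := B) deep J ι κ A K ε o r) := by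
  cases r with
  | letter a => exact (allFinite fun _ => (const _).imp (all (le _ _))).and (holds₁ _ _)
  | conn c => exact exFinite fun τ => (const _).and (isNode deep hB τ _)
  | prop => exact exFinite fun τ => (const _).and (isNode deep hB τ _)
  | name => exact exFinite fun τ => (const _).and ((isNode deep hB τ _).and
      ((allFinite fun _ => (const _).imp (all (le _ _))).and (nameCode deep _ _)))
  | arg c i => exact exFinite fun τ => exFinite fun τ' => (const _).and ((isNode deep hB τ _).and
      ((isNode deep hB τ' _).and (((const _).and ((eq _ _).and (allFinite fun _ => eq _ _))).or
      (exFinite fun v => (const _).and ((extendsBy v _ _).and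
        (all ((lt _ _).imp (le _ _))))))))
  | below =>
    exact exFinite fun τ => exFinite fun τ' => (isNode deep hB τ _).and
      ((isNode deep hB τ' _).and (((const _).and ((eq _ _).and (allFinite fun _ => eq _ _))).or
      (exFinite fun v => (const _).and (extendsBy v _ _))))

end Definable

/-! ### The reduction -/

/-- Letter positions and digit indices are below `n` in the input and keep their value in the larger
output table; both sides say that `u` is such a small number. -/
theorem digits_small_iff {n k : ℕ} {o : Fin k} (ho : (o : ℕ) = 0) (u : Fin (n ^ k)) :
    (∀ i, i ≠ o → ∀ y, finFunctionFinEquiv.symm u i ≤ y) ↔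
      ((finFunctionFinEquiv.symm u o : Fin n) : ℕ) = u := by
  have hval : ∀ i, ((finFunctionFinEquiv.symm u i : Fin n) : ℕ) = u / n ^ (i : ℕ) % n :=
    fun i => rfl
  have hn : 0 < n := (Nat.zero_le _).trans_lt (finFunctionFinEquiv.symm u o).2
  constructor
  · intro h
    conv_rhs => rw [← finFunctionFinEquiv.apply_symm_apply u, finFunctionFinEquiv_apply]
    rw [Finset.sum_eq_single o]
    · simp [ho]
    · intro i _ hi
      have := Fin.le_def.1 (h i hi ⟨0, hn⟩)
      simp only [Nat.le_zero] at this
      rw [this, zero_mul]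
    · simp
  · intro h i hi y
    have hu : (u : ℕ) < n := by rw [← h]; exact (finFunctionFinEquiv.symm u o).2
    have hi : (i : ℕ) ≠ 0 := fun e => hi (Fin.ext (e.trans ho.symm))
    rw [Fin.le_def, hval, Nat.div_eq_of_lt (hu.trans_le (Nat.le_pow (by omega)))]
    simp

section

variable {S : Type} {B B' : Finset BoolFn} {deep : Prop} {J : ∀ f : BoolFn, Finset (Fin f.1)}
  {M : Type} [CommMonoid M] {ι : Bool ≃ M} {κ : BoolFn → M} {n : ℕ} {T : Table (instVoc S B) n}

theorem leafName_lt (l : List ℕ) : leafName deep J T l < 2 ^ n := by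
  unfold leafName
  split_ifs
  · exact nodeName_lt T _
  · exact nodeName_lt T _
  · positivity

/-- The digits of an element of the output table. -/
def digitsOf {A : Fml} {K : (Bool → Bool) → Fml} {k : ℕ} (ε : Digit A K ≃ Fin k)
    (u : Fin (n ^ k)) : Digit A K → Fin n := fun x => finFunctionFinEquiv.symm u (ε x)

section

variable {A : Fml} {K : (Bool → Bool) → Fml} {k : ℕ} (ε : Digit A K ≃ Fin k)

theorem digitsOf_injective : Function.Injective (digitsOf (n := n) ε) := by
  intro u v h
  apply finFunctionFinEquiv.symm.injective
  funext i
  simpa [digitsOf] using congrFun h (ε.symm i)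

theorem exists_digitsOf_eq (t : Digit A K → Fin n) : ∃ u, digitsOf ε u = t :=
  ⟨finFunctionFinEquiv fun i => t (ε.symm i), by funext x; simp [digitsOf]⟩

/-- The nodes of the output formula can be numbered according to their codes. -/
theorem exists_numbering (hn : n ≠ 0) (kind : List ℕ → Bool → Bool) :
    ∃ ν : List ℕ → Fin (n ^ k), ∀ (w : List (Leaf A)) (τ : Tag A K),
      Fits kind (treeDepth deep n) w τ →
        CodesWord w (digitsOf ε (ν (wordAddr w ++ τ.1.2))) ∧
        CodesTag τ (digitsOf ε (ν (wordAddr w ++ τ.1.2))) := by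
  have : ∀ p : List ℕ, ∃ u : Fin (n ^ k), ∀ (w : List (Leaf A)) (τ : Tag A K),
      Fits kind (treeDepth deep n) w τ → wordAddr w ++ τ.1.2 = p →
        CodesWord w (digitsOf ε u) ∧ CodesTag τ (digitsOf ε u) := by
    intro p
    by_cases h : ∃ (w : List (Leaf A)) (τ : Tag A K),
        Fits kind (treeDepth deep n) w τ ∧ wordAddr w ++ τ.1.2 = p
    · obtain ⟨w, τ, hf, rfl⟩ := h
      obtain ⟨t, ht⟩ := exists_code deep hn hf.length_le τ
      obtain ⟨u, rfl⟩ := exists_digitsOf_eq ε t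
      refine ⟨u, fun w' τ' hf' e => ?_⟩
      obtain ⟨rfl, rfl⟩ := hf'.addr_injective hf e
      exact ht
    -- Addresses that lead to no node get an arbitrary number.
    · exact ⟨⟨0, by positivity⟩, fun w τ hf e => (h ⟨w, τ, hf, e⟩).elim⟩
  choose ν hν using this
  exact ⟨ν, fun w τ hf => hν _ w τ hf rfl⟩

/-- An element codes a fitting pair exactly if it is the number of the corresponding address
(`hnode`), so all other elements are padding. Each output relation then becomes a statement about
addresses in the nested formula. -/
theorem isNodeMap_output (hn : 2 ≤ n) (hA : deep → ∀ m, A ≠ .var m)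
    (huniq : ∀ l i i', Hit deep J T l i → Hit deep J T l i' → i = i')
    {o : Fin k} (ho : (o : ℕ) = 0) {T' : Table (instVoc S B') (n ^ k)}
    (hT' : ∀ z : (instVoc S B').Entry (n ^ k), T' z = true ↔ outRel deep J ι κ A K ε o z.1 n T
      fun ij => finFunctionFinEquiv.symm (z.2 ij.1) ij.2) :
    ∃ ν, IsNodeMap T' (nest A (bottom (leafKind deep J ι κ T) (leafName deep J T) K)
      (treeDepth deep n) []) ν := by
  have hk : k ≠ 0 := by have := o.2; omega
  have hAd : 0 < treeDepth deep n → ∀ m, A ≠ .var m := fun h => hA <| by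
    by_contra hd
    simp [treeDepth, hd] at h
  obtain ⟨ν, hν⟩ := exists_numbering (deep := deep) ε (by omega : n ≠ 0) (leafKind deep J ι κ T)
  have hnode : ∀ τ u, IsNode deep J ι κ τ T (digitsOf ε u) ↔ ∃ w,
      Fits (leafKind deep J ι κ T) (treeDepth deep n) w τ ∧ ν (wordAddr w ++ τ.1.2) = u := by
    intro τ u
    rw [isNode_iff]
    constructor
    · rintro ⟨w, hw, hτ, hf⟩
      exact ⟨w, hf, digitsOf_injective ε (code_unique (hν w τ hf).1 (hν w τ hf).2 hw hτ)⟩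
    · rintro ⟨w, hf, rfl⟩
      exact ⟨w, (hν w τ hf).1, (hν w τ hf).2, hf⟩
  refine ⟨ν, ?_, ?_, ?_, ?_, ?_, ?_, ?_⟩
  · intro p q hp hq e
    obtain ⟨w, τ, hf, rfl⟩ := exists_fits (kind := leafKind deep J ι κ T) hp
    obtain ⟨w', τ', hf', rfl⟩ := exists_fits (kind := leafKind deep J ι κ T) hq
    obtain ⟨h1, h2⟩ := hν w τ hf
    obtain ⟨h1', h2'⟩ := hν w' τ' hf'
    rw [e] at h1 h2
    rw [h1.ext h1', h2.ext hn h2']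
  · intro p m hp
    obtain ⟨w, τ, hf, rfl⟩ := exists_fits (kind := leafKind deep J ι κ T)
      (by rw [hp]; simp : _ ≠ none)
    rw [((hf.subAt_var_iff _).1 hp).2]
    exact (leafName_lt _).trans_le (Nat.pow_le_pow_right (by simp) (Nat.le_pow (by omega)))
  · intro c u
    refine (hT' _).trans (Iff.trans (b := ∃ τ : Tag A K,
      (∃ args, (block A K τ.1.1).subAt τ.1.2 = some (.app c.1 args)) ∧
      IsNode deep J ι κ τ T (digitsOf ε u)) Iff.rfl ?_)
    simp only [hnode]
    constructor
    · rintro ⟨τ, hc, w, hf, rfl⟩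
      obtain ⟨args, h⟩ := (hf.subAt_app_iff _).2 hc
      exact ⟨_, args, h, rfl⟩
    · rintro ⟨p, args, hp, rfl⟩
      obtain ⟨w, τ, hf, rfl⟩ := exists_fits (kind := leafKind deep J ι κ T)
        (by rw [hp]; simp : _ ≠ none)
      exact ⟨τ, (hf.subAt_app_iff _).1 ⟨args, hp⟩, w, hf, rfl⟩
  · intro u
    refine (hT' _).trans (Iff.trans (b := ∃ τ : Tag A K,
      (∃ m, (block A K τ.1.1).subAt τ.1.2 = some (.var m)) ∧
      IsNode deep J ι κ τ T (digitsOf ε u)) Iff.rfl ?_)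
    simp only [hnode]
    constructor
    · rintro ⟨τ, hc, w, hf, rfl⟩
      exact ⟨_, _, (hf.subAt_var_iff _).2 ⟨hc, rfl⟩, rfl⟩
    · rintro ⟨p, m, hp, rfl⟩
      obtain ⟨w, τ, hf, rfl⟩ := exists_fits (kind := leafKind deep J ι κ T)
        (by rw [hp]; simp : _ ≠ none)
      exact ⟨τ, ((hf.subAt_var_iff _).1 hp).1, w, hf, rfl⟩
  · intro u j
    refine (hT' _).trans (Iff.trans (b := ∃ τ : Tag A K,
      (∃ m, (block A K τ.1.1).subAt τ.1.2 = some (.var m)) ∧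
      IsNode deep J ι κ τ T (digitsOf ε u) ∧
      (∀ i : Fin k, i ≠ o → ∀ y, finFunctionFinEquiv.symm j i ≤ y) ∧
      NameCode deep J T (digitsOf ε u) (finFunctionFinEquiv.symm j o)) Iff.rfl ?_)
    simp only [hnode]
    constructor
    · rintro ⟨τ, hc, ⟨w, hf, rfl⟩, hj, hb⟩
      rw [(hν w τ hf).1.nameCode_iff huniq, (digits_small_iff ho j).1 hj] at hb
      exact ⟨_, _, (hf.subAt_var_iff _).2 ⟨hc, rfl⟩, rfl, hb⟩
    · rintro ⟨p, m, hp, rfl, hb⟩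
      obtain ⟨w, τ, hf, rfl⟩ := exists_fits (kind := leafKind deep J ι κ T)
        (by rw [hp]; simp : _ ≠ none)
      obtain ⟨hc, rfl⟩ := (hf.subAt_var_iff _).1 hp
      -- Names of propositions stay below `2 ^ n` although the table has grown to size `n ^ k`, so a
      -- nonzero digit has an index below `n`.
      have hj : (j : ℕ) < n := by
        by_contra! h
        rw [Nat.testBit_lt_two_pow] at hb
        · simp at hb
        · exact (leafName_lt _).trans_le (Nat.pow_le_pow_right (by simp) h)
      have hj' : ((finFunctionFinEquiv.symm j o : Fin n) : ℕ) = j := by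
        change (j : ℕ) / n ^ (o : ℕ) % n = j
        rw [ho, pow_zero, Nat.div_one, Nat.mod_eq_of_lt hj]
      refine ⟨τ, hc, ⟨w, hf, rfl⟩, (digits_small_iff ho j).2 hj', ?_⟩
      rwa [(hν w τ hf).1.nameCode_iff huniq, hj']
  · intro c i u v
    refine (hT' _).trans (Iff.trans (b := ∃ τ τ' : Tag A K,
      (∃ args, (block A K τ.1.1).subAt τ.1.2 = some (.app c.1 args)) ∧
      IsNode deep J ι κ τ T (digitsOf ε u) ∧ IsNode deep J ι κ τ' T (digitsOf ε v) ∧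
      ((τ'.1.2 = τ.1.2 ++ [(i : ℕ)] ∧ digitsOf ε u none = digitsOf ε v none ∧
        ∀ x, digitsOf ε u (some (.inl x)) = digitsOf ε v (some (.inl x))) ∨
      ∃ x : Leaf A, (x.1 = τ.1.2 ++ [(i : ℕ)] ∧ τ'.1.2 = []) ∧
        ExtendsBy x (digitsOf ε u) (digitsOf ε v) ∧
        ∀ z, digitsOf ε u none < z → digitsOf ε v none ≤ z)) Iff.rfl ?_)
    simp only [hnode]
    constructor
    · rintro ⟨τ, τ', hc, ⟨w, hf, rfl⟩, ⟨w', hf', rfl⟩, h⟩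
      obtain ⟨args, hp⟩ := (hf.subAt_app_iff _).2 hc
      refine ⟨_, args, hp, rfl, ?_⟩
      congr 1
      refine ((wordAddr_eq_snoc_iff hAd hf.length_le hf'.length_le hf.isInner hf'.isInner).2 ?_).symm
      rcases h with ⟨hq, h⟩ | ⟨x, ⟨hx, hq⟩, he, hz⟩
      · exact .inl ⟨((hν w τ hf).1.same_iff (hν w' τ' hf').1).1 h, hq⟩
      · obtain ⟨w₂, rfl⟩ := ((hν w τ hf).1.extendsBy_iff (hν w' τ' hf').1 x).1 he
        have h1 := (hν w τ hf).1.1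
        have h2 := (hν _ τ' hf').1.1
        have h3 := (digitsOf ε (ν (wordAddr (w ++ x :: w₂) ++ τ'.1.2)) none).2
        simp only [List.length_append, List.length_cons] at h2
        -- The successor of the first length is an element, because the second length is at least as
        -- large and is itself an element.
        have h4 := Fin.le_def.1 (hz ⟨w.length + 1, by omega⟩ (Fin.lt_def.2 (by simp [h1])))
        simp only [h2] at h4
        obtain rfl : w₂ = [] := List.length_eq_zero_iff.1 (by omega)
        exact .inr ⟨x, rfl, hx, hq⟩
    · rintro ⟨p, args, hp, rfl, rfl⟩
      obtain ⟨w, τ, hf, rfl⟩ := exists_fits (kind := leafKind deep J ι κ T)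
        (by rw [hp]; simp : _ ≠ none)
      obtain ⟨w', τ', hf', e⟩ := exists_fits (kind := leafKind deep J ι κ T)
        (by rw [subAt_snoc hp i]; simp : _ ≠ none)
      refine ⟨τ, τ', (hf.subAt_app_iff _).1 ⟨args, hp⟩, ⟨w, hf, rfl⟩, ⟨w', hf', by rw [e]⟩, ?_⟩
      rw [← e]
      rcases (wordAddr_eq_snoc_iff hAd hf.length_le hf'.length_le hf.isInner hf'.isInner).1 e with
        ⟨rfl, hq⟩ | ⟨x, rfl, hx, hq⟩
      · exact .inl ⟨hq, ((hν w τ hf).1.same_iff (hν w τ' hf').1).2 rfl⟩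
      · refine .inr ⟨x, ⟨hx, hq⟩, ((hν w τ hf).1.extendsBy_iff (hν _ τ' hf').1 x).2 ⟨[], rfl⟩,
          fun z hz => ?_⟩
        have h1 := (hν w τ hf).1.1
        have h2 := (hν _ τ' hf').1.1
        rw [Fin.lt_def, h1] at hz
        rw [Fin.le_def, h2]
        simpa using hz
  · intro u v
    refine (hT' _).trans (Iff.trans (b := ∃ τ τ' : Tag A K,
      IsNode deep J ι κ τ T (digitsOf ε u) ∧ IsNode deep J ι κ τ' T (digitsOf ε v) ∧
      ((τ.1.2 <+: τ'.1.2 ∧ digitsOf ε u none = digitsOf ε v none ∧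
        ∀ x, digitsOf ε u (some (.inl x)) = digitsOf ε v (some (.inl x))) ∨
      ∃ x : Leaf A, τ.1.2 <+: x.1 ∧ ExtendsBy x (digitsOf ε u) (digitsOf ε v))) Iff.rfl ?_)
    simp only [hnode]
    have hiff : ∀ (w w' : List (Leaf A)) (τ τ' : Tag A K)
        (hf : Fits (leafKind deep J ι κ T) (treeDepth deep n) w τ)
        (hf' : Fits (leafKind deep J ι κ T) (treeDepth deep n) w' τ'),
        wordAddr w ++ τ.1.2 <+: wordAddr w' ++ τ'.1.2 ↔ _ := fun w w' τ τ' hf hf' =>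
      wordAddr_prefix_iff hf.length_le hf'.length_le hf.isInner hf'.isInner
    constructor
    · rintro ⟨τ, τ', ⟨w, hf, rfl⟩, ⟨w', hf', rfl⟩, h⟩
      refine ⟨_, _, hf.subAt_ne_none, hf'.subAt_ne_none, (hiff _ _ _ _ hf hf').2 ?_, rfl, rfl⟩
      rcases h with ⟨hq, h⟩ | ⟨x, hx, he⟩
      · exact .inl ⟨((hν w τ hf).1.same_iff (hν w' τ' hf').1).1 h, hq⟩
      · obtain ⟨w₂, rfl⟩ := ((hν w τ hf).1.extendsBy_iff (hν w' τ' hf').1 x).1 he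
        exact .inr ⟨x, w₂, rfl, hx⟩
    · rintro ⟨p, q, hp, hq, hpq, rfl, rfl⟩
      obtain ⟨w, τ, hf, rfl⟩ := exists_fits (kind := leafKind deep J ι κ T) hp
      obtain ⟨w', τ', hf', rfl⟩ := exists_fits (kind := leafKind deep J ι κ T) hq
      refine ⟨τ, τ', ⟨w, hf, rfl⟩, ⟨w', hf', rfl⟩, ?_⟩
      rcases (hiff _ _ _ _ hf hf').1 hpq with ⟨rfl, h⟩ | ⟨x, w₂, rfl, h⟩
      · exact .inl ⟨h, ((hν w τ hf).1.same_iff (hν w τ' hf').1).2 rfl⟩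
      · exact .inr ⟨x, h, ((hν w τ hf).1.extendsBy_iff (hν _ τ' hf').1 x).2 ⟨w₂, rfl⟩⟩

end

theorem exists_reduction_of_templates {par : Prop} {P : FmlProblem S}
    (hP : P.Invariant (B : Set BoolFn)) (hB : IsProductBase par ι (B : Set BoolFn) J κ)
    (hdeep : deep ↔ ∃ f ∈ B, 2 ≤ (J f).card) {A : Fml} (hAB : A.IsOver (B' : Set BoolFn))
    (hA : deep → ∀ σ, ι (A.eval σ) = ∏ k : Fin 5, ι (σ k)) {K : (Bool → Bool) → Fml}
    (hKB : ∀ g, (K g).IsOver (B' : Set BoolFn))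
    (hK : ∀ φ : Fml, φ.IsOver (B : Set BoolFn) →
      ∀ b, (K fun b => φ.eval fun _ => b).eval (fun _ => b) = φ.eval fun _ => b)
    {k : ℕ} (ε : Digit A K ≃ Fin k) (o : Fin k) (ho : (o : ℕ) = 0) :
    ∃ F : CircuitMap (instVoc S B) (instVoc S B'), (F.XorFree ∨ par) ∧ F.Reduces P := by
  obtain ⟨F, hF, rfl, hrun⟩ := exists_circuitMap (W := instVoc S B') k
    (outRel (B := B) deep J ι κ A K ε o) fun r => Definable.outRel deep hB ε o r
  refine ⟨F, hF, ?_⟩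
  rintro n T ⟨x, φ⟩ hz
  obtain ⟨hn, hφ, hx, hl, ν, hν⟩ := encodes_iff.1 hz
  let ψ := nest A (bottom (leafKind deep J ι κ T) (leafName deep J T) K) (treeDepth deep n) []
  have hψ : ψ.IsOver (B' : Set BoolFn) :=
    isOver_nest hAB (fun l => by
      unfold bottom
      exact Fml.isOver_subst (hKB _) fun _ => trivial) _ _
  -- Only two functions occur at the bottom: the identity, induced by a single proposition, and the
  -- common-value function, induced by `φ`.
  have hequiv : φ.Equiv ψ := equiv_nest hB hdeep hν hφ hn hA <| by
    rintro g (rfl | rfl) b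
    · exact hK (.var 0) trivial b
    · exact hK φ hφ b
  have hk : F.k ≠ 0 := by have := o.2; omega
  have hle : n ≤ n ^ F.k := Nat.le_pow (by omega)
  refine ⟨(x, ψ), encodes_iff.2 ⟨hn.trans hle, hψ, hx.trans hle, ?_, ?_⟩, ?_⟩
  · intro a i
    refine (hrun n T _).trans (Iff.trans (b :=
      (∀ i' : Fin F.k, i' ≠ o → ∀ y, finFunctionFinEquiv.symm i i' ≤ y) ∧
        holds₁ T (.letter a) (finFunctionFinEquiv.symm i o)) Iff.rfl ?_)
    rw [digits_small_iff ho, hl]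
    constructor
    · rintro ⟨e, h⟩
      rwa [e] at h
    · intro h
      have hi : (i : ℕ) < n := by
        by_contra! hge
        rw [List.getElem?_eq_none (by omega)] at h
        cases h
      have e : ((finFunctionFinEquiv.symm i o : Fin n) : ℕ) = i := by
        change (i : ℕ) / n ^ (o : ℕ) % n = i
        rw [ho, pow_zero, Nat.div_one, Nat.mod_eq_of_lt hi]
      exact ⟨e, by rw [e]; exact h⟩
  · exact isNodeMap_output ε hn (fun hd m => ne_var_of_eval_eq_prod (by simp) (hA hd) m)
      (fun l i i' h h' => Hit.eq hdeep hν hφ hn h h') ho fun z => hrun n T z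
  · simp only [FmlProblem.restrict, Set.mem_ofPred_eq, hφ, hψ, and_true]
    exact hP x φ ψ hφ hequiv

theorem exists_reduction {par : Prop} {P : FmlProblem S}
    (hP : P.Invariant (B : Set BoolFn)) (hBB' : (B : Set BoolFn) ⊆ clone (B' : Set BoolFn))
    (hB : IsProductBase par ι (B : Set BoolFn) J κ) :
    ∃ F : CircuitMap (instVoc S B) (instVoc S B'), (F.XorFree ∨ par) ∧ F.Reduces P := by
  obtain ⟨A, hAB, hA⟩ : ∃ A : Fml, A.IsOver (B' : Set BoolFn) ∧
      ((∃ f ∈ B, 2 ≤ (J f).card) → ∀ σ, ι (A.eval σ) = ∏ k : Fin 5, ι (σ k)) := by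
    by_cases h : ∃ f ∈ B, 2 ≤ (J f).card
    · obtain ⟨f, hf, hc⟩ := h
      obtain ⟨A, hA, hv⟩ := hB.exists_product_five hf hc
      obtain ⟨A', hA', he⟩ := exists_equiv_of_subset_clone hBB' hA
      exact ⟨A', hA', fun _ σ => by rw [← he σ, hv]⟩
    -- The product then has depth zero, and the template is never evaluated.
    · exact ⟨.var 0, trivial, fun h' => (h h').elim⟩
  -- There are only four unary functions, so the bottom blocks are fixed independently of the input.
  -- A function induced by no `B`-formula gets a dummy block.
  have hK : ∀ g : Bool → Bool, ∃ χ : Fml, χ.IsOver (B' : Set BoolFn) ∧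
      ((∃ φ : Fml, φ.IsOver (B : Set BoolFn) ∧ g = fun b => φ.eval fun _ => b) →
        ∀ b, χ.eval (fun _ => b) = g b) := by
    intro g
    by_cases h : ∃ φ : Fml, φ.IsOver (B : Set BoolFn) ∧ g = fun b => φ.eval fun _ => b
    · obtain ⟨φ, hφ, rfl⟩ := h
      obtain ⟨χ, hχ, he⟩ := exists_equiv_of_subset_clone hBB' hφ
      exact ⟨χ, hχ, fun _ b => (he _).symm⟩
    · exact ⟨.var 0, trivial, fun h' => (h h').elim⟩
  choose K hKB hK using hK
  obtain ⟨k, ⟨ε⟩⟩ := Finite.exists_equiv_fin (Digit A K)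
  have hk : 0 < k := (Nat.zero_le _).trans_lt (ε none).2
  exact exists_reduction_of_templates hP hB Iff.rfl hAB hA hKB (fun φ hφ => hK _ ⟨φ, hφ, rfl⟩)
    ε ⟨0, hk⟩ rfl

end

/-! ### The three kinds of clones -/

theorem subset_clone (B : Set BoolFn) : B ⊆ clone B := fun _ hf _ _ hC => hC hf

theorem prod_bool_eq_true {α : Type} (I : Finset α) (a : α → Bool) :
    ∏ i ∈ I, a i = true ↔ ∀ i ∈ I, a i = true := by
  classical
  induction I using Finset.induction_on with
  | empty => exact iff_of_true rfl (by simp)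
  | insert i I hi ih =>
    rw [Finset.prod_insert hi, Finset.forall_mem_insert, ← ih]
    exact Bool.and_eq_true_iff

theorem sum_bool_eq {α : Type} (I : Finset α) (a : α → Bool) :
    ∑ i ∈ I, a i = decide (Odd (I.filter fun i => a i = true).card) := by
  classical
  induction I using Finset.induction_on with
  | empty => rfl
  | insert i I hi ih =>
    rw [Finset.sum_insert hi, ih, Finset.filter_insert]
    change xor (a i) _ = _
    cases h : a i
    · simp
    · rw [if_pos rfl, Finset.card_insert_of_notMem (by simp [hi])]
      by_cases ho : Odd (I.filter fun i => a i = true).card <;> simp [Nat.odd_add_one, ho]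

theorem exists_isProductBase_of_forall {M : Type} [CommMonoid M] {par : Prop} {ι : Bool ≃ M}
    {B : Set BoolFn}
    (hf : ∀ f ∈ B, ∃ (I : Finset (Fin f.1)) (c : M), ∀ a, ι (f.2 a) = c * ∏ i ∈ I, ι (a i))
    (hM : (∀ x : M, x * x = 1) ∧ par) :
    ∃ J κ, IsProductBase par ι B J κ := by
  have : ∀ f : BoolFn, ∃ (I : Finset (Fin f.1)) (c : M),
      f ∈ B → ∀ a, ι (f.2 a) = c * ∏ i ∈ I, ι (a i) := by
    intro f
    by_cases h : f ∈ B
    · obtain ⟨I, c, h'⟩ := hf f h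
      exact ⟨I, c, fun _ => h'⟩
    · exact ⟨∅, 1, fun h' => (h h').elim⟩
  choose J κ hJ using this
  exact ⟨J, κ, hJ, .inr hM⟩

/-- A constant function is assigned no relevant arguments; a product proper needs no constant. This
gives `κ f = 1` whenever `J f` is nonempty. -/
theorem exists_isProductBase_of_idempotent {ι : Bool ≃ Bool} {B : Set BoolFn}
    (hf : ∀ f ∈ B, (∃ c : Bool, ∀ a, f.2 a = c) ∨
      ∃ I : Finset (Fin f.1), ∀ a, ι (f.2 a) = true ↔ ∀ i ∈ I, ι (a i) = true) :
    ∃ J κ, IsProductBase False ι B J κ := by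
  have : ∀ f : BoolFn, ∃ (I : Finset (Fin f.1)) (c : Bool), f ∈ B →
      (∀ a, ι (f.2 a) = c * ∏ i ∈ I, ι (a i)) ∧ (I.Nonempty → c = 1) := by
    intro f
    by_cases h : f ∈ B
    · rcases hf f h with ⟨c, hc⟩ | ⟨I, hI⟩
      · exact ⟨∅, ι c, fun _ => by simp [hc]⟩
      · refine ⟨I, 1, fun _ => ⟨fun a => ?_, fun _ => rfl⟩⟩
        rw [Bool.eq_iff_iff, hI, one_mul, prod_bool_eq_true]
    · exact ⟨∅, 1, fun h' => (h h').elim⟩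
  choose J κ hJ using this
  exact ⟨J, κ, fun f hf => (hJ f hf).1, .inl ⟨by decide, fun f hf => (hJ f hf).2⟩⟩

theorem exists_isProductBase_of_subset_cloneE {B : Set BoolFn} (h : B ⊆ cloneE) :
    ∃ J κ, IsProductBase False (Equiv.refl Bool) B J κ :=
  exists_isProductBase_of_idempotent fun _ hf => h hf

/-- By De Morgan's law, negation turns disjunctions into conjunctions. -/
theorem exists_isProductBase_of_subset_cloneV {B : Set BoolFn} (h : B ⊆ cloneV) :
    ∃ J κ, IsProductBase False Equiv.boolNot B J κ :=
  exists_isProductBase_of_idempotent fun f hf => (h hf).imp_right fun ⟨I, hI⟩ => ⟨I, fun a => by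
    have := (hI a).not
    simpa using this⟩

/-- Addition in `Bool` is exclusive or, so `Multiplicative Bool` is the group of order two. -/
theorem exists_isProductBase_of_subset_cloneL {B : Set BoolFn} (h : B ⊆ cloneL) :
    ∃ J κ, IsProductBase (M := Multiplicative Bool) True Multiplicative.ofAdd B J κ := by
  refine exists_isProductBase_of_forall (fun f hf => ?_) ⟨by decide, trivial⟩
  obtain ⟨c, I, hI⟩ := h hf
  refine ⟨I, Multiplicative.ofAdd c, fun a => ?_⟩
  rw [hI, ← sum_bool_eq, ← ofAdd_sum, ← ofAdd_add]
  rfl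

end PostLattice

theorem mainTheorem4 {S : Type} [Finite S] (B : Finset PostLattice.BoolFn)
    (P : PostLattice.FmlProblem S)
    (hP : P.Invariant (B : Set PostLattice.BoolFn))
    (B' : Finset PostLattice.BoolFn)
    (hB : (B : Set PostLattice.BoolFn) ⊆ PostLattice.clone (B' : Set PostLattice.BoolFn)) :
    ((PostLattice.clone (B : Set PostLattice.BoolFn) ⊆ PostLattice.cloneE ∨
        PostLattice.clone (B : Set PostLattice.BoolFn) ⊆ PostLattice.cloneV) →
      PostLattice.ReducesAC0 P B B') ∧
    (PostLattice.clone (B : Set PostLattice.BoolFn) ⊆ PostLattice.cloneL →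
      PostLattice.ReducesAC0Mod2 P B B') := by
  refine ⟨?_, fun h => ?_⟩
  · rintro (h | h)
    · obtain ⟨J, κ, hJ⟩ := PostLattice.exists_isProductBase_of_subset_cloneE
        ((PostLattice.subset_clone _).trans h)
      obtain ⟨F, hF, hr⟩ := PostLattice.exists_reduction hP hB hJ
      -- Here `par` is `False`, so the family has no MOD-2 gates.
      exact ⟨F, hF.resolve_right id, hr⟩
    · obtain ⟨J, κ, hJ⟩ := PostLattice.exists_isProductBase_of_subset_cloneV
        ((PostLattice.subset_clone _).trans h)
      obtain ⟨F, hF, hr⟩ := PostLattice.exists_reduction hP hB hJ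
      exact ⟨F, hF.resolve_right id, hr⟩
  · obtain ⟨J, κ, hJ⟩ := PostLattice.exists_isProductBase_of_subset_cloneL
      ((PostLattice.subset_clone _).trans h)
    obtain ⟨F, -, hr⟩ := PostLattice.exists_reduction hP hB hJ
    exact ⟨F, hr⟩
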